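/- Let $\mathbb{F}\in\{\mathbb{R},\mathbb{C}\}$ and let $\delta=(d_n)_{n=1}^\infty$ be a non-decreasing sequence of integers with $d_n\ge 2$. *The Lindenstrauss basis and its dual.* Put $\sigma(k)=2+\sum_{j=1}^{k-1}d_j$ for $k\ge1$, let $\rho(j)=\max\{k\ge 1:\sigma(k)\le j\}$ for $j\ge 2$, let $\Lambda(n)=\sigma^{(n)}(1)$ for $n\ge 0$ ($\sigma^{(n)}$ is the $n$-th iterate), and let $\Gamma(m)=\max\{n\ge 0:\Lambda(n)\le m\}$ for $m\ge 1$. With $(\mathbf{e}_k)_{k\ge1}$ the unit vectors, let $$\mathbf{x}_k=\mathbf{e}_k-\frac1{d_k}\sum_{j=\sigma(k)}^{\sigma(k+1)-1}\mathbf{e}_j\in\ell_1,\qquad \mathbf{x}_j^*=\sum_{n=0}^{\Gamma(j)}\Big(\prod_{r=1}^n\frac1{d_{\rho^{(r)}(j)}}\Big)\mathbf{e}_{\rho^{(n)}(j)} .$$ Let $\mathbb{X}_1$ be the closed linear span of $(\mathbf{x}_k)_k$ in $\ell_1$. Regard $\mathbf{x}_j^*$ as the element $x\mapsto\sum_i \mathbf{x}_j^*(i)\,x(i)$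 of the dual space $\mathbb{X}_1^*$, and let $\mathbb{X}_{1,0}^*$ be the closed linear span of $\mathcal{X}_1^*=(\mathbf{x}_j^*)_j$ in $\mathbb{X}_1^*$, with the dual norm. Then $\mathcal{X}_1^*$ is a basis of $\mathbb{X}_{1,0}^*$ whose coordinate functionals are $\varphi\mapsto\varphi(\mathbf{x}_j)$. *Constants of a basis.* For a basis $\mathcal{B}=(\mathbf{y}_n)_n$ with coordinate functionals $(\mathbf{y}_n^*)_n$ of a Banach space $\mathbb{Y}$ and finite $A\subset\mathbb{N}$, let $S_A(f)=\sum_{n\in A}\mathbf{y}_n^*(f)\mathbf{y}_n$. Let $\mathcal{G}_m(f)=S_A(f)$, where $A$ is any chosen set with $|A|=m$ and $|\mathbf{y}_n^*(f)|\ge|\mathbf{y}_k^*(f)|$ for all $n\in A$, $k\notin A$. With $A$ ranging over finite sets and signs $\gamma$ over families of scalars of modulus one, put $$\Phi^u_m=\sup_{|A|\le m}\Big\|\sum_{n\in A}\mathbf{y}_n\Big\|,\quad \Phi^{u,s}_m=\sup_{|A|\le m,\,\gamma}\Big\|\sum_{n\in A}\gamma_n\mathbf{y}_n\Big\|,\quad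 \Phi^l_m=\inf_{|A|\ge m}\Big\|\sum_{n\in A}\mathbf{y}_n\Big\|,\quad \Phi^{l,s}_m=\inf_{|A|\ge m,\,\gamma}\Big\|\sum_{n\in A}\gamma_n\mathbf{y}_n\Big\|,$$ and $k_m=\sup_{|A|\le m}\|S_A\|$. Let $\mathbf{L}^q_m$, $\mathbf{L}^a_m$, $\mathbf{L}_m$ be the smallest constants $C\in[0,\infty]$ such that, respectively, for all $f\in\mathbb{Y}$: $\max\{\|\mathcal{G}_m(f)\|,\|f-\mathcal{G}_m(f)\|\}\le C\|f\|$; $\|f-\mathcal{G}_m(f)\|\le C\|f-S_A(f)\|$ for every $A$ with $|A|=m$; $\|f-\mathcal{G}_m(f)\|\le C\inf\|f-z\|$, the infimum being over all $m$-term linear combinations $z$ of vectors of $\mathcal{B}$. **Theorem.** For the basis $\mathcal{X}_1^*$ of $\mathbb{X}_{1,0}^*$ and $m\ge 2$, $$\Phi^u_m\approx\Phi^{u,s}_m\approx\mathbf{L}^q_m\approx\mathbf{L}^a_m\approx\mathbf{L}_m\approx k_m\approx\Gamma(m)\qquad\text{and}\qquad \Phi^l_m\approx\Phi^{l,s}_m\approx1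 .$$ Here $\approx$ means equivalence up to multiplicative constants; these can be taken independent of $m$, of $\delta$ and of the choices made in the definition of $\mathcal{G}_m$. -/

import Mathlib

set_option maxSynthPendingDepth 3

open scoped NNReal ENNReal

noncomputable section

/-! ## Bases and the constants of greedy approximation

Everywhere below `‖x‖ₑ` is the norm of `x`, seen as an element of `[0, ∞]`. -/

section GreedyApproximation

variable {𝕜 : Type*} [RCLike 𝕜] {Y : Type*} [NormedAddCommGroup Y] [NormedSpace 𝕜 Y]

/-- A semi-normalized fundamental `M`-bounded Markushevich basis of `Y`: the sequence `vec`
together with its (uniquely determined) coordinate functionals `coord`. -/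
structure SemiNormalizedBasis (𝕜 : Type*) [RCLike 𝕜] (Y : Type*) [NormedAddCommGroup Y]
    [NormedSpace 𝕜 Y] where
  vec : ℕ → Y
  coord : ℕ → StrongDual 𝕜 Y
  biorthogonal : ∀ i j, coord i (vec j) = if i = j then 1 else 0
  fundamental : (Submodule.span 𝕜 (Set.range vec)).topologicalClosure = ⊤
  vec_bounded_below : ∃ c : ℝ, 0 < c ∧ ∀ n, c ≤ ‖vec n‖
  coord_bounded : ∃ C : ℝ, ∀ n, ‖coord n‖ ≤ C

namespace SemiNormalizedBasis

variable (B : SemiNormalizedBasis 𝕜 Y)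

/-- The coordinate projection `S_A(f) = ∑_{n ∈ A} y_n^*(f) y_n`. -/
def proj (A : Finset ℕ) : Y →L[𝕜] Y :=
  ∑ n ∈ A, (B.coord n).smulRight (B.vec n)

/-- `k_m = sup_{|A| ≤ m} ‖S_A‖`. -/
def conditionality (m : ℕ) : ℝ≥0∞ :=
  ⨆ (A : Finset ℕ) (_ : A.card ≤ m), ‖B.proj A‖ₑ

/-- `Φ_m^u = sup_{|A| ≤ m} ‖∑_{n ∈ A} y_n‖`. -/
def upperDemocracy (m : ℕ) : ℝ≥0∞ :=
  ⨆ (A : Finset ℕ) (_ : A.card ≤ m), ‖∑ n ∈ A, B.vec n‖ₑ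

/-- `Φ_m^{u,s}`, the supremum of `‖∑_{n ∈ A} γ_n y_n‖` over `|A| ≤ m` and signs `γ`
(scalars of modulus one). -/
def upperSuperDemocracy (m : ℕ) : ℝ≥0∞ :=
  ⨆ (A : Finset ℕ) (_ : A.card ≤ m) (γ : ℕ → 𝕜) (_ : ∀ n, ‖γ n‖ = 1),
    ‖∑ n ∈ A, γ n • B.vec n‖ₑ

/-- `Φ_m^l = inf_{|A| ≥ m} ‖∑_{n ∈ A} y_n‖`, over finite sets `A`. -/
def lowerDemocracy (m : ℕ) : ℝ≥0∞ :=
  ⨅ (A : Finset ℕ) (_ : m ≤ A.card), ‖∑ n ∈ A, B.vec n‖ₑ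

/-- `Φ_m^{l,s}`, the infimum of `‖∑_{n ∈ A} γ_n y_n‖` over finite `A` with `|A| ≥ m` and
signs `γ`. -/
def lowerSuperDemocracy (m : ℕ) : ℝ≥0∞ :=
  ⨅ (A : Finset ℕ) (_ : m ≤ A.card) (γ : ℕ → 𝕜) (_ : ∀ n, ‖γ n‖ = 1),
    ‖∑ n ∈ A, γ n • B.vec n‖ₑ

/-- `A` is a greedy set of `f`: no coefficient outside `A` is larger than one inside `A`. -/
def IsGreedySet (f : Y) (A : Finset ℕ) : Prop :=
  ∀ n ∈ A, ∀ k ∉ A, ‖B.coord k f‖ ≤ ‖B.coord n f‖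

/-- `G` is a greedy algorithm for the basis: `G m f = 𝒢_m(f)` is `S_A(f)` for some greedy set `A`
of `f` of cardinality `m`. Greedy sets need not be unique; `G` is any choice of them. -/
def IsGreedyAlgorithm (G : ℕ → Y → Y) : Prop :=
  ∀ m f, ∃ A : Finset ℕ, A.card = m ∧ B.IsGreedySet f A ∧ G m f = B.proj A f

/-- The error `σ_m(f)` of the best `m`-term approximation of `f`. -/
def bestApprox (m : ℕ) (f : Y) : ℝ≥0∞ :=
  ⨅ (A : Finset ℕ) (_ : A.card = m) (a : ℕ → 𝕜), ‖f - ∑ n ∈ A, a n • B.vec n‖ₑ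

/-- The quasi-greedy Lebesgue constant `L_m^q`. -/
def lebesgueQuasiGreedy (_B : SemiNormalizedBasis 𝕜 Y) (G : ℕ → Y → Y) (m : ℕ) : ℝ≥0∞ :=
  sInf {C : ℝ≥0∞ | ∀ f, max ‖G m f‖ₑ ‖f - G m f‖ₑ ≤ C * ‖f‖ₑ}

/-- The almost greedy Lebesgue constant `L_m^a`. -/
def lebesgueAlmostGreedy (G : ℕ → Y → Y) (m : ℕ) : ℝ≥0∞ :=
  sInf {C : ℝ≥0∞ | ∀ f, ∀ A : Finset ℕ, A.card = m → ‖f - G m f‖ₑ ≤ C * ‖f - B.proj A f‖ₑ}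

/-- The (greedy) Lebesgue constant `L_m`. -/
def lebesgue (G : ℕ → Y → Y) (m : ℕ) : ℝ≥0∞ :=
  sInf {C : ℝ≥0∞ | ∀ f, ‖f - G m f‖ₑ ≤ C * B.bestApprox m f}

theorem tendsto_coord (f : Y) :
    Filter.Tendsto (fun n => B.coord n f) Filter.atTop (nhds 0) := by
  obtain ⟨C, hC⟩ := B.coord_bounded
  have hC0 : 0 ≤ C := (norm_nonneg _).trans (hC 0)
  have hspan : ∀ g ∈ Submodule.span 𝕜 (Set.range B.vec),
      ∃ N, ∀ n ≥ N, B.coord n g = 0 := by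
    intro g hg
    induction hg using Submodule.span_induction with
    | mem x hx =>
      obtain ⟨j, rfl⟩ := hx
      refine ⟨j + 1, fun n hn => ?_⟩
      rw [B.biorthogonal, if_neg (by omega)]
    | zero => exact ⟨0, fun n _ => map_zero _⟩
    | add x y _ _ hx hy =>
      obtain ⟨N, hN⟩ := hx
      obtain ⟨M, hM⟩ := hy
      exact ⟨max N M, fun n hn => by
        rw [map_add, hN n (le_of_max_le_left hn), hM n (le_of_max_le_right hn), add_zero]⟩
    | smul a x _ hx =>
      obtain ⟨N, hN⟩ := hx
      exact ⟨N, fun n hn => by rw [map_smul, hN n hn, smul_zero]⟩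
  rw [Metric.tendsto_atTop]
  intro ε hε
  have hf : f ∈ closure (Submodule.span 𝕜 (Set.range B.vec) : Set Y) := by
    rw [← Submodule.topologicalClosure_coe, B.fundamental]; trivial
  obtain ⟨g, hg, hfg⟩ := Metric.mem_closure_iff.1 hf (ε / (C + 1)) (by positivity)
  obtain ⟨N, hN⟩ := hspan g hg
  refine ⟨N, fun n hn => ?_⟩
  have h1 : B.coord n f = B.coord n (f - g) := by rw [map_sub, hN n hn, sub_zero]
  rw [dist_zero_right, h1]
  rw [dist_eq_norm] at hfg
  calc ‖B.coord n (f - g)‖ ≤ ‖B.coord n‖ * ‖f - g‖ := ContinuousLinearMap.le_opNorm _ _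
    _ ≤ C * ‖f - g‖ := by gcongr; exact hC n
    _ ≤ (C + 1) * ‖f - g‖ := by gcongr; linarith
    _ < (C + 1) * (ε / (C + 1)) := by gcongr
    _ = ε := by field_simp

theorem exists_isGreedySet (m : ℕ) (f : Y) : ∃ A : Finset ℕ, A.card = m ∧ B.IsGreedySet f A := by
  induction m with
  | zero => exact ⟨∅, rfl, by simp [IsGreedySet]⟩
  | succ m ih =>
    obtain ⟨A, hA, hg⟩ := ih
    have hmax : ∃ i, i ∉ A ∧ ∀ k ∉ A, ‖B.coord k f‖ ≤ ‖B.coord i f‖ := by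
      by_cases h0 : ∀ k ∉ A, B.coord k f = 0
      · obtain ⟨i, hi⟩ := Infinite.exists_notMem_finset A
        exact ⟨i, hi, fun k hk => by simp [h0 k hk]⟩
      · push Not at h0
        obtain ⟨k₀, hk₀, hne⟩ := h0
        have ht := Metric.tendsto_atTop.1 (B.tendsto_coord f) ‖B.coord k₀ f‖ (norm_pos_iff.2 hne)
        obtain ⟨N, hN⟩ := ht
        have hk₀N : k₀ < N := by
          by_contra h
          have := hN k₀ (not_lt.1 h)
          simp at this
        have hk₀mem : k₀ ∈ Finset.range N \ A := by simp [hk₀, hk₀N]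
        obtain ⟨i, hi, hmx⟩ := Finset.exists_max_image (Finset.range N \ A)
          (fun k => ‖B.coord k f‖) ⟨k₀, hk₀mem⟩
        refine ⟨i, (Finset.mem_sdiff.1 hi).2, fun k hk => ?_⟩
        by_cases hkN : k < N
        · exact hmx k (by simp [hk, hkN])
        · have h1 := hN k (not_lt.1 hkN)
          rw [dist_zero_right] at h1
          exact h1.le.trans (hmx k₀ hk₀mem)
    obtain ⟨i, hiA, hi⟩ := hmax
    refine ⟨insert i A, by rw [Finset.card_insert_of_notMem hiA, hA], fun n hn k hk => ?_⟩
    have hkA : k ∉ A := fun h => hk (Finset.mem_insert_of_mem h)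
    rcases Finset.mem_insert.1 hn with rfl | hnA
    · exact hi k hkA
    · exact hg n hnA k hkA

/-- Greedy algorithms exist. -/
theorem exists_isGreedyAlgorithm : ∃ G, B.IsGreedyAlgorithm G := by
  choose A hA hg using B.exists_isGreedySet
  exact ⟨fun m f => B.proj (A m f) f, fun m f => ⟨A m f, hA m f, hg m f, rfl⟩⟩

end SemiNormalizedBasis

end GreedyApproximation

/-! ## The Lindenstrauss basis and its dual basis

Sequences and coordinates are indexed from `0`: the index `j` here stands for the index `j + 1` of
the customary notation, in which everything is indexed from `1`. So `d j` is `d_{j+1}`, and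
`sigma d k`, `rho d j` are `σ(k+1) - 1`, `ρ(j+1) - 1`. The functions `Lambda` and `Gamma` are not
shifted. -/

namespace Lindenstrauss

/-- The left inverse `k ↦ max {n | s n ≤ k}` of an increasing `s` (which satisfies `n ≤ s n`). -/
def leftInverse (s : ℕ → ℕ) (k : ℕ) : ℕ :=
  Nat.findGreatest (fun n => s n ≤ k) k

/-- The customary `σ(k) = 2 + ∑_{j=1}^{k-1} d_j` in shifted indices. -/
def sigma (d : ℕ → ℕ) (k : ℕ) : ℕ :=
  1 + ∑ i ∈ Finset.range k, d i

/-- The left inverse of `sigma`; it is only used at arguments `j ≥ 1`. -/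
def rho (d : ℕ → ℕ) : ℕ → ℕ :=
  leftInverse (sigma d)

/-- `Λ(n)`, the `n`-th iterate of (the unshifted) `σ` at `1`. -/
def Lambda (d : ℕ → ℕ) (n : ℕ) : ℕ :=
  (sigma d)^[n] 0 + 1

/-- `Γ(m) = max {n | Λ(n) ≤ m}`, for `m ≥ 1`. -/
def Gamma (d : ℕ → ℕ) : ℕ → ℕ :=
  leftInverse (Lambda d)

section Basis

variable (𝕜 : Type*) [RCLike 𝕜] (d : ℕ → ℕ)

/-- The space `ℓ₁`. -/
abbrev ellOne : Type _ := lp (fun _ : ℕ => 𝕜) 1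

/-- `x_k = e_k - d_k⁻¹ ∑_{σ(k) ≤ j < σ(k+1)} e_j` in `ℓ₁`. -/
def vector (k : ℕ) : ellOne 𝕜 :=
  lp.single 1 k 1 - ((d k : 𝕜)⁻¹) • ∑ j ∈ Finset.Ico (sigma d k) (sigma d (k + 1)), lp.single 1 j 1

/-- The closed linear span `𝕏₁` of the Lindenstrauss basis, in `ℓ₁`. -/
def space : Submodule 𝕜 (ellOne 𝕜) :=
  (Submodule.span 𝕜 (Set.range (vector 𝕜 d))).topologicalClosure

/-- `x_k` as an element of `𝕏₁`. -/
def spaceVec (k : ℕ) : space 𝕜 d :=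
  ⟨vector 𝕜 d k, Submodule.le_topologicalClosure _ (Submodule.subset_span ⟨k, rfl⟩)⟩

/-- The unit vector `e_i`, as the functional `f ↦ f i` on `ℓ₁`. -/
def evalAt (i : ℕ) : StrongDual 𝕜 (ellOne 𝕜) :=
  LinearMap.mkContinuous
    { toFun := fun f => f i
      map_add' := fun _ _ => rfl
      map_smul' := fun _ _ => rfl } 1
    (fun f => (lp.norm_apply_le_norm one_ne_zero f i).trans_eq (one_mul _).symm)

/-- `x_j^* = ∑_{n=0}^{Γ(j)} (∏_{r=1}^{n} d_{ρ^{(r)}(j)}⁻¹) e_{ρ^{(n)}(j)}`, acting on `ℓ₁`. -/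
def functional (j : ℕ) : StrongDual 𝕜 (ellOne 𝕜) :=
  ∑ n ∈ Finset.range (Gamma d (j + 1) + 1),
    (∏ r ∈ Finset.Icc 1 n, (d ((rho d)^[r] j) : 𝕜)⁻¹) • evalAt 𝕜 ((rho d)^[n] j)

/-- `x_j^*` as an element of the dual space `𝕏₁^*`, with its dual norm. -/
def dualFunctional (j : ℕ) : StrongDual 𝕜 (space 𝕜 d) :=
  (functional 𝕜 d j).comp (space 𝕜 d).subtypeL

/-- `𝕏_{1,0}^*`, the closed linear span of `(x_j^*)` in `𝕏₁^*`. -/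
def dualSpace : Submodule 𝕜 (StrongDual 𝕜 (space 𝕜 d)) :=
  (Submodule.span 𝕜 (Set.range (dualFunctional 𝕜 d))).topologicalClosure

/-- `x_j^*` as an element of `𝕏_{1,0}^*`. -/
def dualVec (j : ℕ) : dualSpace 𝕜 d :=
  ⟨dualFunctional 𝕜 d j, Submodule.le_topologicalClosure _ (Submodule.subset_span ⟨j, rfl⟩)⟩

/-- The coordinate functional `φ ↦ φ(x_k)` on `𝕏_{1,0}^*`. -/
def dualCoord (k : ℕ) : StrongDual 𝕜 (dualSpace 𝕜 d) :=
  (ContinuousLinearMap.apply 𝕜 𝕜 (spaceVec 𝕜 d k)).comp (dualSpace 𝕜 d).subtypeL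

end Basis

/-! ### Verification that `(x_j^*)` is a basis of `𝕏_{1,0}^*` -/

section Verification

variable {d : ℕ → ℕ}

theorem sigma_succ (k : ℕ) : sigma d (k + 1) = sigma d k + d k := by
  simp [sigma, Finset.sum_range_succ, add_assoc]

theorem sigma_strictMono (hd : ∀ n, 2 ≤ d n) : StrictMono (sigma d) :=
  strictMono_nat_of_lt_succ fun k => by have := hd k; rw [sigma_succ]; omega

theorem lt_sigma (hd : ∀ n, 2 ≤ d n) (k : ℕ) : k < sigma d k := by
  induction k with
  | zero => simp [sigma]
  | succ k ih => have := hd k; rw [sigma_succ]; omega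

theorem Lambda_zero : Lambda d 0 = 1 := rfl

theorem Lambda_succ (n : ℕ) : Lambda d (n + 1) = sigma d (Lambda d n - 1) + 1 := by
  simp [Lambda, Function.iterate_succ_apply']

theorem Lambda_strictMono (hd : ∀ n, 2 ≤ d n) : StrictMono (Lambda d) :=
  strictMono_nat_of_lt_succ fun n => by
    rw [Lambda_succ]; have := lt_sigma hd (Lambda d n - 1); omega

theorem leftInverse_eq_iff {s : ℕ → ℕ} (hs : StrictMono s) {k n : ℕ} (hk : s 0 ≤ k) :
    leftInverse s k = n ↔ s n ≤ k ∧ k < s (n + 1) := by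
  unfold leftInverse
  constructor
  · intro h
    have h1 : s (Nat.findGreatest (fun n => s n ≤ k) k) ≤ k :=
      Nat.findGreatest_spec (P := fun n => s n ≤ k) (Nat.zero_le k) hk
    subst h
    refine ⟨h1, not_le.1 fun h2 => ?_⟩
    exact Nat.findGreatest_is_greatest (P := fun n => s n ≤ k) (Nat.lt_succ_self _)
      ((hs.id_le _).trans h2) h2
  · rintro ⟨h1, h2⟩
    rw [Nat.findGreatest_eq_iff]
    refine ⟨(hs.id_le n).trans h1, fun _ => h1, fun i hi _ h3 => ?_⟩
    have := hs.monotone (Nat.succ_le_of_lt hi)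
    simp only [Nat.succ_eq_add_one] at this
    omega

theorem rho_eq_iff (hd : ∀ n, 2 ≤ d n) {j k : ℕ} (hj : 1 ≤ j) :
    rho d j = k ↔ sigma d k ≤ j ∧ j < sigma d (k + 1) :=
  leftInverse_eq_iff (sigma_strictMono hd) (by simpa [sigma] using hj)

theorem Gamma_eq_iff (hd : ∀ n, 2 ≤ d n) {m n : ℕ} (hm : 1 ≤ m) :
    Gamma d m = n ↔ Lambda d n ≤ m ∧ m < Lambda d (n + 1) :=
  leftInverse_eq_iff (Lambda_strictMono hd) (by simpa [Lambda] using hm)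

theorem Gamma_one (hd : ∀ n, 2 ≤ d n) : Gamma d 1 = 0 := by
  rw [Gamma_eq_iff hd le_rfl]; simp [Lambda, sigma]

theorem Gamma_rho (hd : ∀ n, 2 ≤ d n) {j : ℕ} (hj : 1 ≤ j) :
    Gamma d (j + 1) = Gamma d (rho d j + 1) + 1 := by
  obtain ⟨h1, h2⟩ := (rho_eq_iff hd hj).1 rfl
  obtain ⟨h3, h4⟩ := (Gamma_eq_iff hd (Nat.le_add_left 1 (rho d j))).1 rfl
  set n := Gamma d (rho d j + 1)
  rw [Gamma_eq_iff hd (by omega), Lambda_succ, Lambda_succ]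
  constructor
  · have := (sigma_strictMono hd).monotone (show Lambda d n - 1 ≤ rho d j by omega)
    omega
  · have := (sigma_strictMono hd).monotone (show rho d j + 1 ≤ Lambda d (n + 1) - 1 by omega)
    omega

variable (𝕜 : Type*) [RCLike 𝕜]

@[simp] theorem evalAt_apply (i : ℕ) (f : ellOne 𝕜) : evalAt 𝕜 i f = f i := rfl

theorem vector_apply (hd : ∀ n, 2 ≤ d n) (k i : ℕ) :
    (vector 𝕜 d k) i =
      (if i = k then 1 else 0) - (if 1 ≤ i ∧ rho d i = k then (d k : 𝕜)⁻¹ else 0) := by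
  have h1 : ∀ j, (lp.single 1 j (1 : 𝕜) : ellOne 𝕜) i = if i = j then 1 else 0 := fun j => by
    rw [lp.single_apply, Pi.single_apply]
  have h2 : (1 ≤ i ∧ rho d i = k) ↔ i ∈ Finset.Ico (sigma d k) (sigma d (k + 1)) := by
    rw [Finset.mem_Ico]
    constructor
    · rintro ⟨hi, h⟩; exact (rho_eq_iff hd hi).1 h
    · intro h
      have hi : 1 ≤ i := by have := lt_sigma hd k; omega
      exact ⟨hi, (rho_eq_iff hd hi).2 h⟩
  simp only [h2]
  unfold vector
  rw [lp.coeFn_sub, Pi.sub_apply, lp.coeFn_smul, Pi.smul_apply, lp.coeFn_sum, Finset.sum_apply]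
  simp only [h1, Finset.sum_ite_eq, smul_eq_mul, mul_ite, mul_one, mul_zero]

theorem functional_zero (hd : ∀ n, 2 ≤ d n) : functional 𝕜 d 0 = evalAt 𝕜 0 := by
  simp [functional, Gamma_one hd]

theorem functional_rec (hd : ∀ n, 2 ≤ d n) {j : ℕ} (hj : 1 ≤ j) :
    functional 𝕜 d j =
      evalAt 𝕜 j + ((d (rho d j) : 𝕜)⁻¹) • functional 𝕜 d (rho d j) := by
  unfold functional
  rw [Gamma_rho hd hj, Finset.sum_range_succ', add_comm, Finset.smul_sum]
  congr 1
  · simp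
  · refine Finset.sum_congr rfl fun n _ => ?_
    rw [smul_smul, Function.iterate_succ_apply]
    congr 1
    have h : Finset.Icc 1 (n + 1) = insert 1 ((Finset.Icc 1 n).map (addRightEmbedding 1)) := by
      ext r
      simp only [Finset.map_add_right_Icc, Finset.mem_insert, Finset.mem_Icc]
      omega
    rw [h, Finset.prod_insert (by simp), Finset.prod_map]
    simp [Function.iterate_succ_apply]

theorem functional_vector (hd : ∀ n, 2 ≤ d n) (j k : ℕ) :
    functional 𝕜 d j (vector 𝕜 d k) = if k = j then 1 else 0 := by
  induction j using Nat.strong_induction_on with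
  | _ j ih =>
    rcases Nat.eq_zero_or_pos j with rfl | hj
    · rw [functional_zero 𝕜 hd, evalAt_apply, vector_apply 𝕜 hd]
      simp [eq_comm]
    · have hlt : rho d j < j :=
        (lt_sigma hd _).trans_le ((rho_eq_iff hd hj).1 rfl).1
      rw [functional_rec 𝕜 hd hj]
      simp only [add_apply, smul_apply, evalAt_apply, vector_apply 𝕜 hd, ih _ hlt]
      have hj' : 1 ≤ j := hj
      by_cases h : rho d j = k
      · subst h; simp [hj', eq_comm]
      · simp [hj', h, Ne.symm h, eq_comm]

theorem norm_vector_le (hd : ∀ n, 2 ≤ d n) (k : ℕ) : ‖vector 𝕜 d k‖ ≤ 2 := by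
  have h1 : ∀ j, ‖(lp.single 1 j (1 : 𝕜) : ellOne 𝕜)‖ = 1 := fun j => by
    rw [lp.norm_single one_pos, norm_one]
  have hdk : (d k : ℝ) ≠ 0 := by have := hd k; positivity
  calc ‖vector 𝕜 d k‖
      ≤ ‖(lp.single 1 k (1 : 𝕜) : ellOne 𝕜)‖ + ‖((d k : 𝕜)⁻¹) •
          ∑ j ∈ Finset.Ico (sigma d k) (sigma d (k + 1)), (lp.single 1 j (1 : 𝕜) : ellOne 𝕜)‖ :=
        norm_sub_le _ _
    _ ≤ 1 + (d k : ℝ)⁻¹ * ∑ j ∈ Finset.Ico (sigma d k) (sigma d (k + 1)),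
          ‖(lp.single 1 j (1 : 𝕜) : ellOne 𝕜)‖ := by
        rw [h1, norm_smul, norm_inv, RCLike.norm_natCast]
        gcongr
        exact norm_sum_le _ _
    _ = 2 := by
        simp only [h1, Finset.sum_const, Nat.card_Ico, sigma_succ, Nat.add_sub_cancel_left,
          nsmul_eq_mul, mul_one]
        rw [inv_mul_cancel₀ hdk]; norm_num

theorem dualCoord_dualVec (hd : ∀ n, 2 ≤ d n) (k j : ℕ) :
    dualCoord 𝕜 d k (dualVec 𝕜 d j) = if k = j then 1 else 0 :=
  functional_vector 𝕜 hd j k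

theorem norm_dualCoord_le (hd : ∀ n, 2 ≤ d n) (k : ℕ) : ‖dualCoord 𝕜 d k‖ ≤ 2 := by
  refine ContinuousLinearMap.opNorm_le_bound _ zero_le_two fun φ => ?_
  calc ‖dualCoord 𝕜 d k φ‖ = ‖(φ : StrongDual 𝕜 (space 𝕜 d)) (spaceVec 𝕜 d k)‖ := rfl
    _ ≤ ‖(φ : StrongDual 𝕜 (space 𝕜 d))‖ * ‖spaceVec 𝕜 d k‖ := ContinuousLinearMap.le_opNorm _ _
    _ ≤ ‖φ‖ * 2 := by
        gcongr
        · exact le_rfl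
        · exact norm_vector_le 𝕜 hd k
    _ = 2 * ‖φ‖ := mul_comm _ _

end Verification

/-- The dual Lindenstrauss basis `𝒳₁^* = (x_j^*)` of `𝕏_{1,0}^*`. -/
def dualBasis (𝕜 : Type*) [RCLike 𝕜] (d : ℕ → ℕ) (hd : ∀ n, 2 ≤ d n) :
    SemiNormalizedBasis 𝕜 (dualSpace 𝕜 d) where
  vec := dualVec 𝕜 d
  coord := dualCoord 𝕜 d
  biorthogonal := dualCoord_dualVec 𝕜 hd
  fundamental := by
    rw [Submodule.eq_top_iff']
    intro φ
    have hφ : (φ : StrongDual 𝕜 (space 𝕜 d)) ∈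
        closure (Submodule.span 𝕜 (Set.range (dualFunctional 𝕜 d)) : Set _) := φ.2
    rw [← SetLike.mem_coe, Submodule.topologicalClosure_coe, Metric.mem_closure_iff]
    intro ε hε
    obtain ⟨ψ, hψ, hdist⟩ := Metric.mem_closure_iff.1 hφ ε hε
    refine ⟨⟨ψ, Submodule.le_topologicalClosure _ hψ⟩, ?_, hdist⟩
    have himg : (Submodule.span 𝕜 (Set.range (dualVec 𝕜 d))).map (dualSpace 𝕜 d).subtype =
        Submodule.span 𝕜 (Set.range (dualFunctional 𝕜 d)) := by
      rw [Submodule.map_span, ← Set.range_comp]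
      rfl
    have hψ' : ψ ∈ (Submodule.span 𝕜 (Set.range (dualVec 𝕜 d))).map (dualSpace 𝕜 d).subtype := by
      rw [himg]; exact hψ
    obtain ⟨χ, hχ, rfl⟩ := hψ'
    exact hχ
  vec_bounded_below := by
    refine ⟨1 / 2, by norm_num, fun n => ?_⟩
    have h1 : ‖dualCoord 𝕜 d n (dualVec 𝕜 d n)‖ = 1 := by
      rw [dualCoord_dualVec 𝕜 hd, if_pos rfl, norm_one]
    have h2 := ContinuousLinearMap.le_opNorm (dualCoord 𝕜 d n) (dualVec 𝕜 d n)
    have h3 := norm_dualCoord_le 𝕜 hd n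
    have h4 := norm_nonneg (dualVec 𝕜 d n)
    nlinarith
  coord_bounded := ⟨2, norm_dualCoord_le 𝕜 hd⟩

end Lindenstrauss

/-- `a` and `b` agree up to the multiplicative constant `C`, in both directions. -/
def ComparableWith (C : ℝ≥0) (a b : ℝ≥0∞) : Prop :=
  a ≤ C * b ∧ b ≤ C * a

end

/-!
Read `ρ` as the parent map of a tree with root `0`, in which `k` has the `d k` children
`σ(k), …, σ(k+1) - 1`. The `i`-th coordinate `weight d i j` of `x_j^*` is the probability that the
random walk from `i` to uniformly chosen children passes through `j`, and `Γ(j)` (unshifted) is the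
order of the generation of `j`.

*Upper estimates.* The norm of `∑ a_j x_j^*` is at most the supremum over `i` of its `i`-th
coordinate `∑ a_j weight d i j`. Below `i`, each generation has total weight `1`, and since `d` is
non-decreasing the weights decrease and the generations are no smaller than those of the root. So
`m` nodes have total weight at most `Γ(m) + 1` (`sum_weight_le`). As the coordinate functionals have
norm at most `2`, this bounds `Φ^u_m`, `Φ^{u,s}_m`, `k_m` and `L^q_m`. For `L_m`, if `z` is
supported on `D` and `A` is a greedy set of `f`, then
`f - S_A f = (f - z) - S_{A ∪ D}(f - z) + S_{D \ A} f`, where the coefficients in the last term are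
dominated by coefficients of `f - z` (`IsGreedySet.norm_sub_proj_le`).

*Lower estimates.* The vector `∑_{k < Λ(n) - 1} weight d 0 k • x_k` telescopes to
norm `2`, and it pairs with the sum of `x_j^*` over a generation of order less than `n` to `1`
(`norm_sum_weight_mul_dualCoord_le`). Hence the sum over the even generations of order at most
`Γ(m)`, and likewise over the odd ones, has norm of order `Γ(m)`. The alternating sum of the
generations has coordinates in `{-1, 0}`, so its norm is at most `1`
(`norm_sum_dualVec_even_sub_odd_le`). This gives the lower bound of `k_m`. For the Lebesgue
constants the coefficients on the even generations are increased by `1 / (Γ(m) + 1)`, and a sum over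
a far part of the leftmost branch is added to make the greedy set of cardinality `m` unique. Sums
over that branch have norm at most `2` by geometric decay (`norm_sum_dualVec_branch_le`), which also
bounds `Φ^l_m` from above.
-/

/-! ### The tree and its weights -/

namespace Lindenstrauss

section Weights

variable {d : ℕ → ℕ}

theorem rho_lt (hd : ∀ n, 2 ≤ d n) {j : ℕ} (hj : 1 ≤ j) : rho d j < j :=
  (lt_sigma hd _).trans_le ((rho_eq_iff hd hj).1 rfl).1

theorem one_le_of_mem_children (hd : ∀ n, 2 ≤ d n) {k j : ℕ}
    (hj : j ∈ Finset.Ico (sigma d k) (sigma d (k + 1))) : 1 ≤ j := by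
  have := lt_sigma hd k
  have := (Finset.mem_Ico.1 hj).1
  omega

theorem rho_of_mem_children (hd : ∀ n, 2 ≤ d n) {k j : ℕ}
    (hj : j ∈ Finset.Ico (sigma d k) (sigma d (k + 1))) : rho d j = k :=
  (rho_eq_iff hd (one_le_of_mem_children hd hj)).2 (Finset.mem_Ico.1 hj)

theorem rho_mono (hd : ∀ n, 2 ≤ d n) {j k : ℕ} (hj : 1 ≤ j) (hjk : j ≤ k) :
    rho d j ≤ rho d k := by
  have h1 := ((rho_eq_iff hd hj).1 rfl).1
  have h2 := ((rho_eq_iff hd (hj.trans hjk)).1 rfl).2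
  have h3 := (sigma_strictMono hd).lt_iff_lt.1 ((h1.trans hjk).trans_lt h2)
  omega

theorem iterate_sigma_strictMono (hd : ∀ n, 2 ≤ d n) (n : ℕ) : StrictMono (sigma d)^[n] :=
  (sigma_strictMono hd).iterate n

theorem iterate_sigma_strictMono_index (hd : ∀ n, 2 ≤ d n) (i : ℕ) :
    StrictMono fun n => (sigma d)^[n] i :=
  strictMono_nat_of_lt_succ fun n => by
    rw [Function.iterate_succ_apply']; exact lt_sigma hd _

/-- The `i`-th coordinate of `x_j^*`. If `ρ` is read as the parent map of a tree, in which `k` has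
the `d k` children `σ(k), …, σ(k+1) - 1`, this is the probability that the random walk from `i`
which moves to a uniformly chosen child at each step passes through `j`. -/
noncomputable def weight (d : ℕ → ℕ) (i j : ℕ) : ℝ :=
  functional ℝ d j (lp.single 1 i 1)

theorem weight_zero_right (hd : ∀ n, 2 ≤ d n) (i : ℕ) :
    weight d i 0 = if i = 0 then 1 else 0 := by
  rw [weight, functional_zero ℝ hd, evalAt_apply, lp.single_apply, Pi.single_apply]
  simp [eq_comm]

theorem weight_rec (hd : ∀ n, 2 ≤ d n) (i : ℕ) {j : ℕ} (hj : 1 ≤ j) :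
    weight d i j = (if i = j then 1 else 0) + (d (rho d j) : ℝ)⁻¹ * weight d i (rho d j) := by
  rw [weight, functional_rec ℝ hd hj, add_apply, smul_apply, evalAt_apply, lp.single_apply,
    Pi.single_apply, weight, smul_eq_mul]
  simp [eq_comm]

theorem functional_single (𝕜 : Type*) [RCLike 𝕜] (hd : ∀ n, 2 ≤ d n) (i j : ℕ) :
    functional 𝕜 d j (lp.single 1 i 1) = (weight d i j : 𝕜) := by
  induction j using Nat.strong_induction_on with
  | _ j ih =>
    rcases Nat.eq_zero_or_pos j with rfl | hj
    · rw [weight_zero_right hd, functional_zero 𝕜 hd, evalAt_apply, lp.single_apply,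
        Pi.single_apply]
      by_cases h : i = 0
      · simp [h]
      · simp [h, Ne.symm h]
    · rw [functional_rec 𝕜 hd hj, weight_rec hd i hj, add_apply, smul_apply, evalAt_apply,
        lp.single_apply, Pi.single_apply, ih _ (rho_lt hd hj)]
      by_cases h : i = j
      · simp [h]
      · simp [h, Ne.symm h]

theorem weight_nonneg (hd : ∀ n, 2 ≤ d n) (i j : ℕ) : 0 ≤ weight d i j := by
  induction j using Nat.strong_induction_on with
  | _ j ih =>
    rcases Nat.eq_zero_or_pos j with rfl | hj
    · rw [weight_zero_right hd]; split_ifs <;> norm_num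
    · rw [weight_rec hd i hj]
      have := ih _ (rho_lt hd hj)
      split_ifs <;> positivity

theorem weight_of_lt (hd : ∀ n, 2 ≤ d n) {i j : ℕ} (hji : j < i) : weight d i j = 0 := by
  induction j using Nat.strong_induction_on with
  | _ j ih =>
    rcases Nat.eq_zero_or_pos j with rfl | hj
    · rw [weight_zero_right hd, if_neg hji.ne']
    · rw [weight_rec hd i hj, ih _ (rho_lt hd hj) ((rho_lt hd hj).trans hji), if_neg hji.ne']
      simp

theorem weight_self (hd : ∀ n, 2 ≤ d n) (i : ℕ) : weight d i i = 1 := by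
  rcases Nat.eq_zero_or_pos i with rfl | hi
  · simp [weight_zero_right hd]
  · rw [weight_rec hd i hi, weight_of_lt hd (rho_lt hd hi)]; simp

theorem weight_child (hd : ∀ n, 2 ≤ d n) {i k j : ℕ}
    (hj : j ∈ Finset.Ico (sigma d k) (sigma d (k + 1))) (hij : i ≠ j) :
    weight d i j = (d k : ℝ)⁻¹ * weight d i k := by
  rw [weight_rec hd i (one_le_of_mem_children hd hj), rho_of_mem_children hd hj, if_neg hij,
    zero_add]

/-- A nonzero weight is at least every later one, since the sequence `d` is monotone. -/
theorem weight_anti (hd : ∀ n, 2 ≤ d n) (hmono : Monotone d) {i j k : ℕ} (hjk : j ≤ k)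
    (hj : weight d i j ≠ 0) : weight d i k ≤ weight d i j := by
  induction k using Nat.strong_induction_on generalizing j with
  | _ k ih =>
    have hij : i ≤ j := not_lt.1 fun h => hj (weight_of_lt hd h)
    rcases hij.eq_or_lt with rfl | hij
    · rcases hjk.eq_or_lt with rfl | hjk
      · exact le_rfl
      have hk : 1 ≤ k := by omega
      rw [weight_self hd, weight_rec hd i hk, if_neg hjk.ne, zero_add]
      have h1 : weight d i (rho d k) ≤ 1 := by
        by_cases h : i ≤ rho d k
        · exact (ih _ (rho_lt hd hk) h hj).trans_eq (weight_self hd i)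
        · rw [weight_of_lt hd (not_le.1 h)]; exact zero_le_one
      refine mul_le_one₀ (inv_le_one_of_one_le₀ ?_) (weight_nonneg hd _ _) h1
      exact_mod_cast one_le_two.trans (hd _)
    · have hj1 : 1 ≤ j := by omega
      have hk1 : 1 ≤ k := by omega
      rw [weight_rec hd i hj1, if_neg hij.ne, zero_add] at hj ⊢
      rw [weight_rec hd i hk1, if_neg (by omega), zero_add]
      have hρ := rho_mono hd hj1 hjk
      have hpos : (0 : ℝ) < d (rho d j) := by
        have := hd (rho d j); positivity
      refine mul_le_mul (inv_anti₀ hpos ?_) (ih _ (rho_lt hd hk1) hρ (right_ne_zero_of_mul hj))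
        (weight_nonneg hd _ _) (inv_nonneg.2 hpos.le)
      exact_mod_cast hmono hρ

/-- Each step of the walk preserves the total mass. -/
theorem sum_weight_children (hd : ∀ n, 2 ≤ d n) {i a b : ℕ} (hab : a ≤ b) (hi : i < sigma d a) :
    ∑ j ∈ Finset.Ico (sigma d a) (sigma d b), weight d i j =
      ∑ k ∈ Finset.Ico a b, weight d i k := by
  induction b, hab using Nat.le_induction with
  | base => simp
  | succ b hab ih =>
    rw [Finset.sum_Ico_succ_top hab, ← ih, ← Finset.sum_Ico_consecutive _
      ((sigma_strictMono hd).monotone hab) ((sigma_strictMono hd).monotone b.le_succ)]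
    congr 1
    have h0 : (d b : ℝ) ≠ 0 := by have := hd b; positivity
    have hlt : ∀ j ∈ Finset.Ico (sigma d b) (sigma d (b + 1)), i ≠ j := fun j hj => by
      have := (sigma_strictMono hd).monotone hab
      have := (Finset.mem_Ico.1 hj).1
      omega
    rw [Finset.sum_congr rfl fun j hj => weight_child hd hj (hlt j hj), Finset.sum_const,
      Nat.card_Ico, sigma_succ, Nat.add_sub_cancel_left, nsmul_eq_mul, mul_inv_cancel_left₀ h0]

/-- The `n`-th generation of descendants of `i` in the tree with parent map `ρ`. -/
def generation (d : ℕ → ℕ) (i n : ℕ) : Finset ℕ :=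
  Finset.Ico ((sigma d)^[n] i) ((sigma d)^[n] (i + 1))

theorem sum_weight_generation (hd : ∀ n, 2 ≤ d n) (i n : ℕ) :
    ∑ j ∈ generation d i n, weight d i j = 1 := by
  induction n with
  | zero => simp [generation, weight_self hd]
  | succ n ih =>
    rw [← ih, generation, Function.iterate_succ_apply', Function.iterate_succ_apply']
    refine sum_weight_children hd ((iterate_sigma_strictMono hd n).monotone i.le_succ) ?_
    exact ((iterate_sigma_strictMono_index hd i).monotone n.zero_le).trans_lt (lt_sigma hd _)

theorem weight_ne_zero_iff (hd : ∀ n, 2 ≤ d n) (i j : ℕ) :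
    weight d i j ≠ 0 ↔ ∃ n, j ∈ generation d i n := by
  induction j using Nat.strong_induction_on with
  | _ j ih =>
    rcases lt_trichotomy j i with hji | rfl | hij
    · simp only [weight_of_lt hd hji, ne_eq, not_true_eq_false, false_iff, not_exists]
      intro n hn
      have h1 := (iterate_sigma_strictMono_index hd i).monotone n.zero_le
      have h2 := (Finset.mem_Ico.1 hn).1
      simp only [Function.iterate_zero, id_eq] at h1
      omega
    · simp only [weight_self hd, ne_eq, one_ne_zero, not_false_eq_true, true_iff]
      exact ⟨0, by simp [generation]⟩
    · have hj : 1 ≤ j := by omega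
      obtain ⟨h1, h2⟩ := (rho_eq_iff hd hj).1 rfl
      have h0 : (d (rho d j) : ℝ)⁻¹ ≠ 0 := by have := hd (rho d j); positivity
      rw [weight_rec hd i hj, if_neg hij.ne, zero_add, mul_ne_zero_iff, and_iff_right h0,
        ih _ (rho_lt hd hj)]
      have hstep : ∀ n, rho d j ∈ generation d i n ↔ j ∈ generation d i (n + 1) := by
        intro n
        simp only [generation, Finset.mem_Ico, Function.iterate_succ_apply']
        have hs := sigma_strictMono hd
        constructor
        · rintro ⟨h3, h4⟩
          exact ⟨(hs.monotone h3).trans h1, h2.trans_le (hs.monotone h4)⟩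
        · rintro ⟨h3, h4⟩
          have h5 := hs.lt_iff_lt.1 (h3.trans_lt h2)
          exact ⟨by omega, hs.lt_iff_lt.1 (h1.trans_lt h4)⟩
      constructor
      · rintro ⟨n, hn⟩; exact ⟨n + 1, (hstep n).1 hn⟩
      · rintro ⟨_ | n, hn⟩
        · simp only [generation, Function.iterate_zero, id_eq, Finset.mem_Ico] at hn; omega
        · exact ⟨n, (hstep n).2 hn⟩

/-- Since `d` is monotone, generations are at least as large as those of the root. -/
theorem card_generation_root_le (hd : ∀ n, 2 ≤ d n) (hmono : Monotone d) (i n : ℕ) :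
    (generation d 0 n).card ≤ (generation d i n).card := by
  have hsigma : ∀ l a b : ℕ, a ≤ b → sigma d (a + l) + sigma d b ≤ sigma d a + sigma d (b + l) := by
    intro l a b hab
    induction l with
    | zero => simp
    | succ l ih =>
      have := hmono (show a + l ≤ b + l by omega)
      rw [← add_assoc, ← add_assoc, sigma_succ, sigma_succ]
      omega
  have hmain : ∀ n : ℕ, (sigma d)^[n] 1 + (sigma d)^[n] i ≤ (sigma d)^[n] 0 +
      (sigma d)^[n] (i + 1) := by
    intro n
    induction n with
    | zero => simp [add_comm]
    | succ n ih =>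
      simp only [Function.iterate_succ_apply']
      have h1 : (sigma d)^[n] 0 ≤ (sigma d)^[n] 1 :=
        (iterate_sigma_strictMono hd n).monotone zero_le_one
      have h2 : (sigma d)^[n] 0 ≤ (sigma d)^[n] i :=
        (iterate_sigma_strictMono hd n).monotone i.zero_le
      obtain ⟨l, hl⟩ := Nat.exists_eq_add_of_le h1
      have h3 := hsigma l _ _ h2
      have h4 := (sigma_strictMono hd).monotone
        (show (sigma d)^[n] i + l ≤ (sigma d)^[n] (i + 1) by omega)
      rw [← hl] at h3
      omega
  have := hmain n
  simp only [generation, Nat.card_Ico, zero_add]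
  omega

theorem sum_card_generation_root (hd : ∀ n, 2 ≤ d n) (n : ℕ) :
    ∑ r ∈ Finset.range n, (generation d 0 r).card = (sigma d)^[n] 0 := by
  induction n with
  | zero => simp
  | succ n ih =>
    have h1 : (sigma d)^[n] (0 + 1) = (sigma d)^[n + 1] 0 := by
      rw [Function.iterate_succ_apply]; simp [sigma]
    have h2 := (iterate_sigma_strictMono_index hd 0).monotone n.le_succ
    simp only [Nat.succ_eq_add_one] at h2
    rw [Finset.sum_range_succ, ih, generation, Nat.card_Ico, h1]
    omega

theorem generation_pairwiseDisjoint (hd : ∀ n, 2 ≤ d n) (i : ℕ) (s : Set ℕ) :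
    s.PairwiseDisjoint (generation d i) := by
  have key : ∀ a b, a < b → Disjoint (generation d i a) (generation d i b) := by
    intro a b hab
    refine Finset.disjoint_left.2 fun j h1 h2 => ?_
    have h3 := (Finset.mem_Ico.1 h1).2
    have h4 := (Finset.mem_Ico.1 h2).1
    have h5 := (iterate_sigma_strictMono_index hd i).monotone (Nat.succ_le_of_lt hab)
    have h6 : (sigma d)^[a] (i + 1) ≤ (sigma d)^[a + 1] i := by
      rw [Function.iterate_succ_apply]
      exact (iterate_sigma_strictMono hd a).monotone (lt_sigma hd i)
    simp only [Nat.succ_eq_add_one] at h5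
    omega
  intro a _ b _ hab
  rcases lt_or_gt_of_ne hab with h | h
  · exact key a b h
  · exact (key b a h).symm

/-- At most `m` weights below `i` sum to at most `Γ(m) + 1`: the first `Γ(m) + 1` generations
below `i` have at least `m` elements, carry the largest weights, and have total weight
`Γ(m) + 1`. -/
theorem sum_weight_le (hd : ∀ n, 2 ≤ d n) (hmono : Monotone d) {m : ℕ} (hm : 1 ≤ m) (i : ℕ)
    {A : Finset ℕ} (hA : A.card ≤ m) : ∑ j ∈ A, weight d i j ≤ Gamma d m + 1 := by
  set n := Gamma d m with hn
  have hlt := ((Gamma_eq_iff hd hm).1 hn.symm).2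
  set T := (Finset.range (n + 1)).biUnion (generation d i) with hT
  have hsum : ∑ j ∈ T, weight d i j = n + 1 := by
    rw [hT, Finset.sum_biUnion (generation_pairwiseDisjoint hd i _)]
    simp [sum_weight_generation hd]
  have hcard : A.card ≤ T.card := by
    rw [hT, Finset.card_biUnion (generation_pairwiseDisjoint hd i _)]
    have h1 := Finset.sum_le_sum fun r (_ : r ∈ Finset.range (n + 1)) =>
      card_generation_root_le hd hmono i r
    rw [sum_card_generation_root hd] at h1
    rw [Lambda] at hlt
    omega
  have hTne : ∀ j ∈ T, weight d i j ≠ 0 := fun j hj => by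
    obtain ⟨r, -, hr⟩ := Finset.mem_biUnion.1 hj
    exact (weight_ne_zero_iff hd i j).2 ⟨r, hr⟩
  have hcompare : ∀ j ∈ T, ∀ k ∉ T, weight d i k ≤ weight d i j := by
    intro j hj k hk
    by_cases h0 : weight d i k = 0
    · rw [h0]; exact weight_nonneg hd _ _
    refine weight_anti hd hmono ?_ (hTne j hj)
    obtain ⟨s, hs⟩ := (weight_ne_zero_iff hd i k).1 h0
    obtain ⟨r, hr, hjr⟩ := Finset.mem_biUnion.1 hj
    have hns : n + 1 ≤ s := by
      by_contra h
      exact hk (Finset.mem_biUnion.2 ⟨s, Finset.mem_range.2 (by omega), hs⟩)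
    have hrs : r + 1 ≤ s := (Nat.succ_le_of_lt (Finset.mem_range.1 hr)).trans hns
    have h3 := (Finset.mem_Ico.1 hjr).2
    have h4 := (Finset.mem_Ico.1 hs).1
    have h5 := (iterate_sigma_strictMono_index hd i).monotone hrs
    have h6 : (sigma d)^[r] (i + 1) ≤ (sigma d)^[r + 1] i := by
      rw [Function.iterate_succ_apply]
      exact (iterate_sigma_strictMono hd r).monotone (lt_sigma hd i)
    exact (h3.trans_le (h6.trans h5)).le.trans h4
  have hdiff : ∑ j ∈ A \ T, weight d i j ≤ ∑ j ∈ T \ A, weight d i j := by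
    have hcd : (A \ T).card ≤ (T \ A).card := by
      have h1 := Finset.card_sdiff_add_card_inter A T
      have h2 := Finset.card_sdiff_add_card_inter T A
      rw [Finset.inter_comm] at h2
      omega
    obtain ⟨g, hg, hinj⟩ := Finset.exists_subset_card_eq hcd
    -- any bijection from `A \ T` to a subset `g` of `T \ A` increases the weights
    let e := Finset.equivOfCardEq hinj.symm
    rw [← Finset.sum_coe_sort]
    calc ∑ j : (A \ T : Finset ℕ), weight d i j ≤ ∑ j : (A \ T : Finset ℕ), weight d i (e j) :=
          Finset.sum_le_sum fun j _ =>
            hcompare _ (Finset.mem_sdiff.1 (hg (e j).2)).1 _ (Finset.mem_sdiff.1 j.2).2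
      _ = ∑ j : g, weight d i j := Equiv.sum_comp e fun j : g => weight d i j
      _ = ∑ j ∈ g, weight d i j := Finset.sum_coe_sort g _
      _ ≤ ∑ j ∈ T \ A, weight d i j :=
          Finset.sum_le_sum_of_subset_of_nonneg hg fun _ _ _ => weight_nonneg hd _ _
  have h1 := Finset.sum_inter_add_sum_sdiff A T (weight d i)
  have h2 := Finset.sum_inter_add_sum_sdiff T A (weight d i)
  rw [Finset.inter_comm] at h2
  linarith

end Weights

end Lindenstrauss

namespace Lindenstrauss

/-! ### Generations and branches as test sets -/

section TestSets

variable {d : ℕ → ℕ}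

theorem iterate_sigma_one (n : ℕ) : (sigma d)^[n] 1 = (sigma d)^[n + 1] 0 := by
  rw [Function.iterate_succ_apply]; simp [sigma]

theorem generation_root (n : ℕ) :
    generation d 0 n = Finset.Ico ((sigma d)^[n] 0) ((sigma d)^[n + 1] 0) := by
  rw [generation, zero_add, iterate_sigma_one]

theorem sum_weight_generation_root (hd : ∀ n, 2 ≤ d n) (i n : ℕ) :
    ∑ j ∈ generation d 0 n, weight d i j = if i < (sigma d)^[n + 1] 0 then 1 else 0 := by
  induction n with
  | zero =>
    have : sigma d 0 = 1 := by simp [sigma]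
    simp [generation_root, this, weight_zero_right hd]
  | succ n ih =>
    have hlt := lt_sigma hd ((sigma d)^[n + 1] 0)
    rw [← Function.iterate_succ_apply' (sigma d), Nat.succ_eq_add_one] at hlt
    have hmono : (sigma d)^[n] 0 ≤ (sigma d)^[n + 1] 0 :=
      (iterate_sigma_strictMono_index hd 0).monotone n.le_succ
    by_cases h1 : i < (sigma d)^[n + 1] 0
    · rw [if_pos (h1.trans hlt), ← if_pos (c := i < (sigma d)^[n + 1] 0) (t := (1 : ℝ)) (e := 0) h1,
        ← ih, generation_root, generation_root, Function.iterate_succ_apply' _ (n + 1),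
        Function.iterate_succ_apply' _ n]
      rw [Function.iterate_succ_apply' _ n] at h1
      refine sum_weight_children hd ?_ h1
      rw [← Function.iterate_succ_apply' (sigma d)]
      exact hmono
    · have hzero : ∀ j ∈ generation d 0 (n + 1), j ≠ i → weight d i j = 0 := by
        intro j hj hji
        rw [generation_root, Finset.mem_Ico] at hj
        have hj1 : 1 ≤ j := by
          have h2 := lt_sigma hd ((sigma d)^[n] 0)
          rw [← Function.iterate_succ_apply' (sigma d), Nat.succ_eq_add_one] at h2
          omega
        have hρ : rho d j < (sigma d)^[n + 1] 0 := by
          refine (sigma_strictMono hd).lt_iff_lt.1 ?_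
          rw [← Function.iterate_succ_apply' (sigma d)]
          exact ((rho_eq_iff hd hj1).1 rfl).1.trans_lt hj.2
        rw [weight_rec hd i hj1, if_neg (Ne.symm hji), weight_of_lt hd (by omega)]
        simp
      split_ifs with h2
      · have hi : i ∈ generation d 0 (n + 1) := by
          rw [generation_root, Finset.mem_Ico]; omega
        rw [Finset.sum_eq_single_of_mem i hi hzero, weight_self hd]
      · refine Finset.sum_eq_zero fun j hj => hzero j hj ?_
        rw [generation_root, Finset.mem_Ico] at hj
        omega

/-- The union of the first `h` generations of even order below the root. -/
def evenGenerations (d : ℕ → ℕ) (h : ℕ) : Finset ℕ :=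
  (Finset.range h).biUnion fun r => generation d 0 (2 * r)

/-- The union of the first `h` generations of odd order below the root. -/
def oddGenerations (d : ℕ → ℕ) (h : ℕ) : Finset ℕ :=
  (Finset.range h).biUnion fun r => generation d 0 (2 * r + 1)

theorem sum_evenGenerations (hd : ∀ n, 2 ≤ d n) (h : ℕ) (f : ℕ → ℝ) :
    ∑ j ∈ evenGenerations d h, f j = ∑ r ∈ Finset.range h, ∑ j ∈ generation d 0 (2 * r), f j := by
  refine Finset.sum_biUnion fun a _ b _ hab => ?_
  exact generation_pairwiseDisjoint hd 0 Set.univ trivial trivial (by omega)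

theorem sum_oddGenerations (hd : ∀ n, 2 ≤ d n) (h : ℕ) (f : ℕ → ℝ) :
    ∑ j ∈ oddGenerations d h, f j =
      ∑ r ∈ Finset.range h, ∑ j ∈ generation d 0 (2 * r + 1), f j := by
  refine Finset.sum_biUnion fun a _ b _ hab => ?_
  exact generation_pairwiseDisjoint hd 0 Set.univ trivial trivial (by omega)

theorem sum_weight_evenGenerations (hd : ∀ n, 2 ≤ d n) (h : ℕ) :
    ∑ j ∈ evenGenerations d h, weight d 0 j = h := by
  simp [sum_evenGenerations hd, sum_weight_generation hd]

theorem sum_weight_oddGenerations (hd : ∀ n, 2 ≤ d n) (h : ℕ) :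
    ∑ j ∈ oddGenerations d h, weight d 0 j = h := by
  simp [sum_oddGenerations hd, sum_weight_generation hd]

theorem lt_of_mem_evenGenerations (hd : ∀ n, 2 ≤ d n) {h j : ℕ} (hj : j ∈ evenGenerations d h) :
    j < (sigma d)^[2 * h - 1] 0 := by
  obtain ⟨r, hr, hjr⟩ := Finset.mem_biUnion.1 hj
  rw [generation_root, Finset.mem_Ico] at hjr
  have := Finset.mem_range.1 hr
  exact hjr.2.trans_le
    ((iterate_sigma_strictMono_index hd 0).monotone (show 2 * r + 1 ≤ 2 * h - 1 by omega))

theorem lt_of_mem_oddGenerations (hd : ∀ n, 2 ≤ d n) {h j : ℕ} (hj : j ∈ oddGenerations d h) :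
    j < (sigma d)^[2 * h] 0 := by
  obtain ⟨r, hr, hjr⟩ := Finset.mem_biUnion.1 hj
  rw [generation_root, Finset.mem_Ico] at hjr
  have := Finset.mem_range.1 hr
  exact hjr.2.trans_le
    ((iterate_sigma_strictMono_index hd 0).monotone (show 2 * r + 1 + 1 ≤ 2 * h by omega))

theorem disjoint_evenGenerations_oddGenerations (hd : ∀ n, 2 ≤ d n) (h : ℕ) :
    Disjoint (evenGenerations d h) (oddGenerations d h) := by
  simp only [evenGenerations, oddGenerations, Finset.disjoint_biUnion_left,
    Finset.disjoint_biUnion_right]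
  intro a _ b _
  exact generation_pairwiseDisjoint hd 0 Set.univ trivial trivial (by omega)

/-- The alternating sum of the generations telescopes coordinatewise. -/
theorem abs_sum_weight_even_sub_odd_le (hd : ∀ n, 2 ≤ d n) (h i : ℕ) :
    |∑ j ∈ evenGenerations d h, weight d i j - ∑ j ∈ oddGenerations d h, weight d i j| ≤ 1 := by
  set s : ℕ → ℝ := fun n => if i < (sigma d)^[n] 0 then 1 else 0 with hs
  have hs1 : ∀ n, s n ≤ s (n + 1) := by
    intro n
    have h1 := (iterate_sigma_strictMono_index hd 0).monotone n.le_succ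
    simp only [hs]
    split_ifs with h2 h3
    · exact le_rfl
    · exact absurd (h2.trans_le h1) h3
    · exact zero_le_one
    · exact le_rfl
  have hle : ∀ n, s n ≤ 1 := fun n => by simp only [hs]; split_ifs <;> norm_num
  have hge : ∀ n, 0 ≤ s n := fun n => by simp only [hs]; split_ifs <;> norm_num
  have heq : ∑ j ∈ evenGenerations d h, weight d i j - ∑ j ∈ oddGenerations d h, weight d i j =
      ∑ r ∈ Finset.range h, (s (2 * r + 1) - s (2 * r + 2)) := by
    rw [sum_evenGenerations hd, sum_oddGenerations hd, ← Finset.sum_sub_distrib]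
    refine Finset.sum_congr rfl fun r _ => ?_
    rw [sum_weight_generation_root hd, sum_weight_generation_root hd]
  have hupper : ∑ r ∈ Finset.range h, (s (2 * r + 1) - s (2 * r + 2)) ≤ 0 :=
    Finset.sum_nonpos fun r _ => sub_nonpos.2 (hs1 _)
  have hlower : ∀ h, s 0 - s (2 * h) ≤ ∑ r ∈ Finset.range h, (s (2 * r + 1) - s (2 * r + 2)) := by
    intro h
    induction h with
    | zero => simp
    | succ h ih =>
      rw [Finset.sum_range_succ]
      have h1 := hs1 (2 * h)
      have h2 : s (2 * (h + 1)) = s (2 * h + 2) := rfl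
      linarith
  rw [heq, abs_le]
  constructor
  · have := hlower h; have := hle (2 * h); have := hge 0; linarith
  · linarith

/-- The nodes of orders `N, …, N + q - 1` on the leftmost branch of the tree. -/
def branch (d : ℕ → ℕ) (N q : ℕ) : Finset ℕ :=
  (Finset.range q).image fun r => (sigma d)^[N + r] 0

theorem card_branch (hd : ∀ n, 2 ≤ d n) (N q : ℕ) : (branch d N q).card = q := by
  rw [branch, Finset.card_image_of_injective, Finset.card_range]
  intro a b hab
  have := (iterate_sigma_strictMono_index hd 0).injective hab
  omega

theorem branch_subset (d : ℕ → ℕ) (N : ℕ) {p q : ℕ} (hpq : p ≤ q) :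
    branch d N p ⊆ branch d N q :=
  Finset.image_subset_image (Finset.range_mono hpq)

theorem le_of_mem_branch (hd : ∀ n, 2 ≤ d n) {N q j : ℕ} (hj : j ∈ branch d N q) :
    (sigma d)^[N] 0 ≤ j := by
  obtain ⟨r, -, rfl⟩ := Finset.mem_image.1 hj
  exact (iterate_sigma_strictMono_index hd 0).monotone (Nat.le_add_right N r)

/-- Along a branch the weights decay geometrically. -/
theorem sum_weight_branch_le (hd : ∀ n, 2 ≤ d n) (N q i : ℕ) :
    ∑ j ∈ branch d N q, weight d i j ≤ 2 := by
  set s : ℕ → ℕ := fun r => (sigma d)^[r] 0 with hs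
  have hinj : Function.Injective s := (iterate_sigma_strictMono_index hd 0).injective
  have hstep : ∀ r, weight d i (s (r + 1)) ≤ (if i = s (r + 1) then 1 else 0) +
      weight d i (s r) / 2 := by
    intro r
    have hmem : s (r + 1) ∈ Finset.Ico (sigma d (s r)) (sigma d (s r + 1)) := by
      simp only [hs, Function.iterate_succ_apply', Finset.mem_Ico, le_refl, true_and]
      exact sigma_strictMono hd (Nat.lt_succ_self _)
    rw [weight_rec hd i (one_le_of_mem_children hd hmem), rho_of_mem_children hd hmem,
      div_eq_inv_mul]
    have h2 : (2 : ℝ) ≤ d (s r) := by exact_mod_cast hd _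
    have := weight_nonneg hd i (s r)
    gcongr
  have hpartial : ∀ M, ∑ r ∈ Finset.range M, weight d i (s r) + 2 * weight d i (s M) ≤
      2 * ∑ r ∈ Finset.range (M + 1), if i = s r then 1 else 0 := by
    intro M
    induction M with
    | zero => by_cases h : i = 0 <;> simp [hs, weight_zero_right hd, h, -Finset.sum_boole]
    | succ M ih =>
      rw [Finset.sum_range_succ, Finset.sum_range_succ _ (M + 1)]
      have := hstep M
      linarith
  have hone : ∀ M, ∑ r ∈ Finset.range M, (if i = s r then (1 : ℝ) else 0) ≤ 1 := by
    intro M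
    by_cases h : ∃ r, i = s r
    · obtain ⟨r, rfl⟩ := h
      simp only [hinj.eq_iff, Finset.sum_ite_eq]
      split_ifs <;> norm_num
    · push Not at h
      simp [h]
  have hsub : branch d N q ⊆ (Finset.range (N + q)).image s := by
    intro j hj
    obtain ⟨r, hr, rfl⟩ := Finset.mem_image.1 hj
    have := Finset.mem_range.1 hr
    exact Finset.mem_image.2 ⟨N + r, Finset.mem_range.2 (by omega), rfl⟩
  have h1 := Finset.sum_le_sum_of_subset_of_nonneg hsub
    fun j _ _ => weight_nonneg hd i j
  rw [Finset.sum_image fun a _ b _ hab => hinj hab] at h1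
  have h2 := hpartial (N + q)
  have h3 := hone (N + q + 1)
  have h4 := weight_nonneg hd i (s (N + q))
  linarith

end TestSets

/-! ### Norms in the dual space -/

section Norms

variable (𝕜 : Type*) [RCLike 𝕜] {d : ℕ → ℕ}

/-- A functional on `ℓ₁` is bounded by its values at the unit vectors. -/
theorem norm_le_of_single {ψ : StrongDual 𝕜 (ellOne 𝕜)} {C : ℝ}
    (hC : ∀ i, ‖ψ (lp.single 1 i 1)‖ ≤ C) : ‖ψ‖ ≤ C := by
  have hC0 : 0 ≤ C := (norm_nonneg _).trans (hC 0)
  refine ContinuousLinearMap.opNorm_le_bound _ hC0 fun f => ?_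
  have hf := lp.hasSum_single (p := 1) ENNReal.one_ne_top f
  have hnorm : HasSum (fun i => ‖f i‖) ‖f‖ := by
    have := lp.hasSum_norm (p := 1) (by norm_num) f
    simpa using this
  have hψ := hf.mapL ψ
  refine (hψ.norm_le_of_bounded (hnorm.mul_left C) fun i => ?_)
  have h1 : (lp.single 1 i (f i) : ellOne 𝕜) = f i • lp.single 1 i 1 := by
    rw [← lp.single_smul, smul_eq_mul, mul_one]
  rw [h1, map_smul, smul_eq_mul, norm_mul, mul_comm]
  exact mul_le_mul_of_nonneg_right (hC i) (norm_nonneg _)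

theorem coe_sum_dualVec (A : Finset ℕ) (a : ℕ → 𝕜) :
    ((∑ j ∈ A, a j • dualVec 𝕜 d j : dualSpace 𝕜 d) : StrongDual 𝕜 (space 𝕜 d)) =
      (∑ j ∈ A, a j • functional 𝕜 d j).comp (space 𝕜 d).subtypeL := by
  ext x
  simp [dualVec, dualFunctional]

/-- `x_j^*` is identified with the sequence of its weights, as an element of `ℓ_∞`. -/
theorem norm_sum_dualVec_le (hd : ∀ n, 2 ≤ d n) (A : Finset ℕ) (a : ℕ → 𝕜) {C : ℝ}
    (hC : ∀ i, ‖∑ j ∈ A, a j * (weight d i j : 𝕜)‖ ≤ C) :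
    ‖∑ j ∈ A, a j • dualVec 𝕜 d j‖ ≤ C := by
  have h1 : ‖∑ j ∈ A, a j • functional 𝕜 d j‖ ≤ C := by
    refine norm_le_of_single 𝕜 fun i => ?_
    simpa [sum_apply, functional_single 𝕜 hd] using hC i
  have hC0 : 0 ≤ C := (norm_nonneg _).trans h1
  rw [Submodule.coe_norm, coe_sum_dualVec]
  refine ContinuousLinearMap.opNorm_le_bound _ hC0 fun x => ?_
  exact ContinuousLinearMap.le_of_opNorm_le _ h1 _

theorem norm_sum_mul_weight_le (hd : ∀ n, 2 ≤ d n) (A : Finset ℕ) (a : ℕ → 𝕜) {t : ℝ}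
    (ha : ∀ j ∈ A, ‖a j‖ ≤ t) (i : ℕ) :
    ‖∑ j ∈ A, a j * (weight d i j : 𝕜)‖ ≤ t * ∑ j ∈ A, weight d i j := by
  rw [Finset.mul_sum]
  refine norm_sum_le_of_le _ fun j hj => ?_
  rw [norm_mul, RCLike.norm_ofReal, abs_of_nonneg (weight_nonneg hd i j)]
  exact mul_le_mul_of_nonneg_right (ha j hj) (weight_nonneg hd i j)

theorem norm_sum_dualVec_le_Gamma (hd : ∀ n, 2 ≤ d n) (hmono : Monotone d) {m : ℕ} (hm : 1 ≤ m)
    {A : Finset ℕ} (hA : A.card ≤ m) (a : ℕ → 𝕜) {t : ℝ} (ht : 0 ≤ t)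
    (ha : ∀ j ∈ A, ‖a j‖ ≤ t) : ‖∑ j ∈ A, a j • dualVec 𝕜 d j‖ ≤ t * (Gamma d m + 1) :=
  norm_sum_dualVec_le 𝕜 hd A a fun i => (norm_sum_mul_weight_le 𝕜 hd A a ha i).trans
    (mul_le_mul_of_nonneg_left (sum_weight_le hd hmono hm i hA) ht)

theorem norm_sum_dualVec_branch_le (hd : ∀ n, 2 ≤ d n) (N q : ℕ) :
    ‖∑ j ∈ branch d N q, dualVec 𝕜 d j‖ ≤ 2 := by
  have h := norm_sum_dualVec_le 𝕜 hd (branch d N q) (fun _ => 1) fun i =>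
    (norm_sum_mul_weight_le 𝕜 hd (branch d N q) (fun _ => (1 : 𝕜)) (t := 1) (by simp) i).trans
      ((one_mul _).trans_le (sum_weight_branch_le hd N q i))
  simpa using h

theorem norm_sum_dualVec_even_sub_odd_le (hd : ∀ n, 2 ≤ d n) (h : ℕ) :
    ‖∑ j ∈ evenGenerations d h, dualVec 𝕜 d j - ∑ j ∈ oddGenerations d h, dualVec 𝕜 d j‖ ≤ 1 := by
  have hdisj := disjoint_evenGenerations_oddGenerations hd h
  set E := evenGenerations d h with hE
  set O := oddGenerations d h with hO
  have hsplit : ∀ {V : Type _} [AddCommGroup V] [Module 𝕜 V] (v : ℕ → V),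
      ∑ j ∈ E ∪ O, (if j ∈ E then (1 : 𝕜) else -1) • v j = ∑ j ∈ E, v j - ∑ j ∈ O, v j := by
    intro V _ _ v
    rw [Finset.sum_union hdisj, sub_eq_add_neg, ← Finset.sum_neg_distrib]
    congr 1
    · exact Finset.sum_congr rfl fun j hj => by simp [hj]
    · exact Finset.sum_congr rfl fun j hj => by simp [Finset.disjoint_right.1 hdisj hj]
  rw [← hsplit]
  refine norm_sum_dualVec_le 𝕜 hd _ _ fun i => ?_
  simp only [← smul_eq_mul]
  rw [hsplit]
  have := abs_sum_weight_even_sub_odd_le hd h i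
  rw [← RCLike.norm_ofReal (K := 𝕜)] at this
  simpa using this

/-- The weights `w` from the root satisfy `w_j = w_{ρ(j)} / d_{ρ(j)}`, so the sum telescopes. -/
theorem sum_weight_smul_vector (hd : ∀ n, 2 ≤ d n) (N : ℕ) :
    ∑ k ∈ Finset.range N, (weight d 0 k : 𝕜) • vector 𝕜 d k =
      lp.single 1 0 1 -
        ∑ j ∈ Finset.Ico N (sigma d N), (weight d 0 j : 𝕜) • (lp.single 1 j 1 : ellOne 𝕜) := by
  induction N with
  | zero => simp [sigma, weight_zero_right hd]
  | succ N ih =>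
    have h1 := lt_sigma hd N
    have h2 := sigma_strictMono hd N.lt_succ_self
    have hchild : ∑ j ∈ Finset.Ico (sigma d N) (sigma d (N + 1)),
        (weight d 0 j : 𝕜) • (lp.single 1 j 1 : ellOne 𝕜) = (weight d 0 N : 𝕜) • (d N : 𝕜)⁻¹ •
          ∑ j ∈ Finset.Ico (sigma d N) (sigma d (N + 1)), (lp.single 1 j 1 : ellOne 𝕜) := by
      rw [Finset.smul_sum, Finset.smul_sum]
      refine Finset.sum_congr rfl fun j hj => ?_
      rw [weight_child hd hj (by have := one_le_of_mem_children hd hj; omega), smul_smul]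
      congr 1
      push_cast
      ring
    rw [Finset.sum_range_succ, ih, vector, smul_sub, ← hchild,
      Finset.sum_eq_sum_Ico_succ_bot h1,
      ← Finset.sum_Ico_consecutive _ (Nat.succ_le_of_lt h1) h2.le]
    abel

/-- Testing on the vector `∑_{k < Λ(n) - 1} w_k x_k` of norm `2`, where `w` are the weights from
the root. -/
theorem norm_sum_weight_mul_dualCoord_le (hd : ∀ n, 2 ≤ d n) (n : ℕ) (φ : dualSpace 𝕜 d) :
    ‖∑ k ∈ Finset.range ((sigma d)^[n] 0), (weight d 0 k : 𝕜) * dualCoord 𝕜 d k φ‖ ≤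
      2 * ‖φ‖ := by
  set N := (sigma d)^[n] 0 with hN
  set x : space 𝕜 d := ∑ k ∈ Finset.range N, (weight d 0 k : 𝕜) • spaceVec 𝕜 d k with hx
  have hxn : ‖x‖ ≤ 2 := by
    have h1 : (x : ellOne 𝕜) = ∑ k ∈ Finset.range N, (weight d 0 k : 𝕜) • vector 𝕜 d k := by
      simp [hx, spaceVec]
    rw [Submodule.coe_norm, h1, sum_weight_smul_vector 𝕜 hd]
    have h2 : ∀ j, ‖(lp.single 1 j (1 : 𝕜) : ellOne 𝕜)‖ = 1 := fun j => by
      rw [lp.norm_single one_pos, norm_one]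
    have h3 : ∑ j ∈ Finset.Ico N (sigma d N), weight d 0 j = 1 := by
      have := sum_weight_generation hd 0 n
      rwa [generation_root, Function.iterate_succ_apply'] at this
    calc _ ≤ ‖(lp.single 1 0 (1 : 𝕜) : ellOne 𝕜)‖ + ∑ j ∈ Finset.Ico N (sigma d N),
            ‖(weight d 0 j : 𝕜) • (lp.single 1 j 1 : ellOne 𝕜)‖ :=
          (norm_sub_le _ _).trans (add_le_add le_rfl (norm_sum_le _ _))
      _ = 2 := by
          simp only [norm_smul, h2, mul_one, RCLike.norm_ofReal,
            abs_of_nonneg (weight_nonneg hd _ _), h3]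
          norm_num
  have hval : (φ : StrongDual 𝕜 (space 𝕜 d)) x =
      ∑ k ∈ Finset.range N, (weight d 0 k : 𝕜) * dualCoord 𝕜 d k φ := by
    simp [hx, dualCoord, RCLike.real_smul_eq_coe_mul]
  rw [← hval]
  calc _ ≤ ‖(φ : StrongDual 𝕜 (space 𝕜 d))‖ * ‖x‖ := ContinuousLinearMap.le_opNorm _ _
    _ ≤ ‖φ‖ * 2 := mul_le_mul_of_nonneg_left hxn (norm_nonneg φ)
    _ = 2 * ‖φ‖ := mul_comm _ _

end Norms

end Lindenstrauss

/-! ### Greedy sets and coordinate projections -/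

namespace SemiNormalizedBasis

variable {𝕜 : Type*} [RCLike 𝕜] {Y : Type*} [NormedAddCommGroup Y] [NormedSpace 𝕜 Y]
  (B : SemiNormalizedBasis 𝕜 Y)

theorem coord_sum_smul_vec (A : Finset ℕ) (a : ℕ → 𝕜) (k : ℕ) :
    B.coord k (∑ n ∈ A, a n • B.vec n) = if k ∈ A then a k else 0 := by
  simp [map_sum, B.biorthogonal]

theorem coord_sum_vec (A : Finset ℕ) (k : ℕ) :
    B.coord k (∑ n ∈ A, B.vec n) = if k ∈ A then 1 else 0 := by
  simpa using B.coord_sum_smul_vec A (fun _ => 1) k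

theorem proj_apply (A : Finset ℕ) (f : Y) : B.proj A f = ∑ n ∈ A, B.coord n f • B.vec n := by
  simp [proj, sum_apply]

theorem proj_sum_smul_vec {A D : Finset ℕ} (hDA : D ⊆ A) (a : ℕ → 𝕜) :
    B.proj A (∑ n ∈ D, a n • B.vec n) = ∑ n ∈ D, a n • B.vec n := by
  simp only [proj_apply, coord_sum_smul_vec, ite_smul, zero_smul, Finset.sum_ite_mem]
  rw [Finset.inter_eq_right.2 hDA]

theorem proj_sum_vec (A D : Finset ℕ) :
    B.proj A (∑ n ∈ D, B.vec n) = ∑ n ∈ A ∩ D, B.vec n := by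
  simp only [proj_apply, coord_sum_vec, ite_smul, zero_smul, one_smul, Finset.sum_ite_mem]

theorem proj_union {A D : Finset ℕ} (h : Disjoint A D) (f : Y) :
    B.proj (A ∪ D) f = B.proj A f + B.proj D f := by
  simp only [proj_apply, Finset.sum_union h]

variable {B}

theorem IsGreedySet.eq_of_lt {f : Y} {A D : Finset ℕ} (hA : B.IsGreedySet f A)
    (hcard : A.card = D.card) (hlt : ∀ k ∈ D, ∀ n ∉ D, ‖B.coord n f‖ < ‖B.coord k f‖) :
    A = D := by
  refine Finset.eq_of_subset_of_card_le (fun n hn => ?_) hcard.ge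
  by_contra hnD
  have hDA : ¬ D ⊆ A := fun h =>
    hnD ((Finset.eq_of_subset_of_card_le h hcard.le).symm ▸ hn)
  obtain ⟨k, hkD, hkA⟩ := Finset.not_subset.1 hDA
  exact (hlt k hkD n hnD).not_ge (hA n hn k hkA)

theorem norm_coord_le {c : ℝ} (hc : ∀ n, ‖B.coord n‖ ≤ c) (n : ℕ) (f : Y) :
    ‖B.coord n f‖ ≤ c * ‖f‖ :=
  (B.coord n).le_of_opNorm_le (hc n) f

theorem norm_proj_apply_le {c K : ℝ} {m : ℕ} (hc : ∀ n, ‖B.coord n‖ ≤ c)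
    (hK : ∀ A : Finset ℕ, A.card ≤ m → ∀ (a : ℕ → 𝕜) (t : ℝ), 0 ≤ t → (∀ n ∈ A, ‖a n‖ ≤ t) →
      ‖∑ n ∈ A, a n • B.vec n‖ ≤ t * K)
    {A : Finset ℕ} (hA : A.card ≤ m) (f : Y) : ‖B.proj A f‖ ≤ c * K * ‖f‖ := by
  have hc0 : 0 ≤ c := (norm_nonneg _).trans (hc 0)
  rw [proj_apply, mul_right_comm]
  exact hK A hA _ _ (by positivity) fun n _ => norm_coord_le hc n f

/-- If `z` is supported on `D`, then `f - S_A f = (f - z) - S_{A ∪ D}(f - z) + S_{D \ A} f`. When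
`A` is a greedy set of `f` as large as `D`, the coefficients of `f` on `D \ A` do not exceed those
on `A \ D`, where `f` and `f - z` have the same coefficients. -/
theorem IsGreedySet.norm_sub_proj_le {c K : ℝ} {m : ℕ} (hc : ∀ n, ‖B.coord n‖ ≤ c)
    (hK : ∀ A : Finset ℕ, A.card ≤ m → ∀ (a : ℕ → 𝕜) (t : ℝ), 0 ≤ t → (∀ n ∈ A, ‖a n‖ ≤ t) →
      ‖∑ n ∈ A, a n • B.vec n‖ ≤ t * K)
    {f : Y} {A D : Finset ℕ} (hA : B.IsGreedySet f A) (hAm : A.card = m) (hDm : D.card = m)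
    (a : ℕ → 𝕜) :
    ‖f - B.proj A f‖ ≤ (1 + 3 * (c * K)) * ‖f - ∑ n ∈ D, a n • B.vec n‖ := by
  have hc0 : 0 ≤ c := (norm_nonneg _).trans (hc 0)
  set z := ∑ n ∈ D, a n • B.vec n with hz
  have hcardDA : (D \ A).card ≤ m := (Finset.card_le_card Finset.sdiff_subset).trans hDm.le
  have hsmall : ‖B.proj (D \ A) f‖ ≤ c * ‖f - z‖ * K := by
    rw [proj_apply]
    refine hK _ hcardDA _ _ (by positivity) fun k hk => ?_
    obtain ⟨hkD, hkA⟩ := Finset.mem_sdiff.1 hk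
    have hne : (A \ D).Nonempty := by
      rw [Finset.sdiff_nonempty]
      intro hAD
      exact hkA ((Finset.eq_of_subset_of_card_le hAD (by omega)).symm ▸ hkD)
    obtain ⟨n, hn⟩ := hne
    obtain ⟨hnA, hnD⟩ := Finset.mem_sdiff.1 hn
    have h1 : B.coord n f = B.coord n (f - z) := by
      rw [map_sub, hz, coord_sum_smul_vec, if_neg hnD, sub_zero]
    exact (hA n hnA k hkA).trans (h1 ▸ norm_coord_le hc n _)
  have hunion : B.proj (A ∪ D) = B.proj A + B.proj (D \ A) := by
    ext g
    rw [← Finset.union_sdiff_self_eq_union, proj_union B Finset.disjoint_sdiff]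
    rfl
  have hident : f - B.proj A f =
      (f - z) - (B.proj A (f - z) + B.proj (D \ A) (f - z)) + B.proj (D \ A) f := by
    have h1 : B.proj A z + B.proj (D \ A) z = z := by
      rw [← add_apply, ← hunion]
      exact proj_sum_smul_vec B Finset.subset_union_right a
    have h2 : B.proj A (f - z) + B.proj (D \ A) (f - z) =
        B.proj A f + B.proj (D \ A) f - z := by
      rw [map_sub, map_sub, sub_add_sub_comm, h1]
    rw [h2]
    abel
  have h1 := norm_proj_apply_le hc hK hAm.le (f - z)
  have h2 := norm_proj_apply_le hc hK hcardDA (f - z)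
  rw [hident]
  calc _ ≤ ‖f - z‖ + (‖B.proj A (f - z)‖ + ‖B.proj (D \ A) (f - z)‖) + ‖B.proj (D \ A) f‖ :=
        (norm_add_le _ _).trans (add_le_add ((norm_sub_le _ _).trans
          (add_le_add le_rfl (norm_add_le _ _))) le_rfl)
    _ ≤ (1 + 3 * (c * K)) * ‖f - z‖ := by linarith

end SemiNormalizedBasis

section ENNReal

variable {E : Type*} [SeminormedAddGroup E]

theorem enorm_le_mul_natCast {x : E} {C : ℝ≥0} {n : ℕ} (h : ‖x‖ ≤ C * n) : ‖x‖ₑ ≤ C * n := by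
  have h1 : ‖x‖₊ ≤ C * n := by exact_mod_cast h
  have h2 := enorm_le_coe.2 h1
  exact_mod_cast h2

theorem natCast_le_mul_enorm {x : E} {C : ℝ≥0} {n : ℕ} (h : n ≤ C * ‖x‖) :
    (n : ℝ≥0∞) ≤ C * ‖x‖ₑ := by
  have h1 : (n : ℝ≥0) ≤ C * ‖x‖₊ := by exact_mod_cast h
  rw [enorm_eq_nnnorm]
  exact_mod_cast h1

theorem enorm_le_mul_enorm {x y : E} {C : ℝ≥0} (h : ‖y‖ ≤ C * ‖x‖) : ‖y‖ₑ ≤ C * ‖x‖ₑ := by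
  have h1 : ‖y‖₊ ≤ C * ‖x‖₊ := by exact_mod_cast h
  rw [enorm_eq_nnnorm, enorm_eq_nnnorm]
  exact_mod_cast h1

theorem ENNReal.le_coe_mul_iff {C : ℝ≥0} (hC : C ≠ 0) {a b : ℝ≥0∞} :
    a ≤ C * b ↔ a / C ≤ b :=
  (ENNReal.div_le_iff' (by exact_mod_cast hC) ENNReal.coe_ne_top).symm

/-- A pair of vectors bounds from below every constant `K` with `‖y‖ ≤ K ‖x‖`. -/
theorem natCast_le_mul_of_enorm_le {x y : E} {C₁ C₂ : ℝ≥0} {n : ℕ} {K : ℝ≥0∞}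
    (hy : n ≤ C₁ * ‖y‖) (hyx : ‖y‖ₑ ≤ K * ‖x‖ₑ) (hx : ‖x‖ ≤ C₂) :
    n ≤ ((C₁ * C₂ : ℝ≥0) : ℝ≥0∞) * K :=
  calc (n : ℝ≥0∞) ≤ C₁ * ‖y‖ₑ := natCast_le_mul_enorm hy
    _ ≤ C₁ * (K * C₂) := by
        gcongr
        refine hyx.trans ?_
        gcongr
        exact enorm_le_coe.2 hx
    _ = ((C₁ * C₂ : ℝ≥0) : ℝ≥0∞) * K := by push_cast; ring

end ENNReal

/-! ### Comparison of the constants from witness sets -/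

namespace SemiNormalizedBasis

variable {𝕜 : Type*} [RCLike 𝕜] {Y : Type*} [NormedAddCommGroup Y] [NormedSpace 𝕜 Y]

/-- Upper estimates for `B`, and finite sets that witness the matching lower estimates: the
indicator sums of `E` and `O` are of order at least `g` but nearly cancel, while those of `P` and
`Q` are bounded. The set `P` completes `E` to a set of cardinality `m`, and `Q` is a set of
cardinality `m` that can be removed without affecting `E` and `O`. -/
structure IsWitness (B : SemiNormalizedBasis 𝕜 Y) (m g : ℕ) (E O P Q : Finset ℕ) : Prop where
  one_le : 1 ≤ g
  norm_coord_le : ∀ n, ‖B.coord n‖ ≤ 2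
  norm_sum_le : ∀ A : Finset ℕ, A.card ≤ m → ∀ (a : ℕ → 𝕜) (t : ℝ), 0 ≤ t →
    (∀ n ∈ A, ‖a n‖ ≤ t) → ‖∑ n ∈ A, a n • B.vec n‖ ≤ t * (g + 1)
  card_E : E.card ≤ m
  card_P : P.card = m - E.card
  card_Q : Q.card = m
  subset : P ⊆ Q
  disjoint_E_O : Disjoint E O
  disjoint_E_Q : Disjoint E Q
  disjoint_O_Q : Disjoint O Q
  norm_sub : ‖∑ n ∈ E, B.vec n - ∑ n ∈ O, B.vec n‖ ≤ 1
  norm_P : ‖∑ n ∈ P, B.vec n‖ ≤ 2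
  norm_Q : ‖∑ n ∈ Q, B.vec n‖ ≤ 2
  le_norm_E : (g : ℝ) ≤ 4 * ‖∑ n ∈ E, B.vec n‖
  le_norm_O : (g : ℝ) ≤ 4 * ‖∑ n ∈ O, B.vec n‖
  le_norm_E_add_P : (g : ℝ) ≤ 4 * ‖∑ n ∈ E, B.vec n + ∑ n ∈ P, B.vec n‖

variable {B : SemiNormalizedBasis 𝕜 Y} {m g : ℕ} {E O P Q : Finset ℕ}

/-- The test vector is the difference of the indicator sums of `E` and `O`, which is bounded, with
the coefficients on `E` slightly enlarged, plus a bounded sum over `P`. Its greedy set of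
cardinality `m` is then `E ∪ P`, whatever the choice of the greedy algorithm. -/
theorem IsWitness.exists_test_vector (hW : B.IsWitness m g E O P Q) {G : ℕ → Y → Y}
    (hG : B.IsGreedyAlgorithm G) :
    ∃ f : Y, ‖f‖ ≤ 6 ∧ ‖f - B.proj Q f‖ ≤ 2 ∧ (g : ℝ) ≤ 4 * ‖G m f‖ ∧
      (g : ℝ) ≤ 4 * ‖f - G m f‖ := by
  have hEO := hW.disjoint_E_O
  have hEP : Disjoint E P := hW.disjoint_E_Q.mono_right hW.subset
  have hOP : Disjoint O P := hW.disjoint_O_Q.mono_right hW.subset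
  -- `ε` is chosen so that the enlargement of the sum over `E` has norm at most `1`
  set ε : ℝ := 1 / (g + 1) with hε
  have hε0 : 0 < ε := by positivity
  have hε1 : ε ≤ 1 := by
    rw [hε, div_le_one (by positivity)]
    have := Nat.cast_nonneg (α := ℝ) g
    linarith
  set v : Finset ℕ → Y := fun D => ∑ j ∈ D, B.vec j with hv
  set b : 𝕜 := ((1 + ε : ℝ) : 𝕜) with hb
  have hbn : ‖b‖ = 1 + ε := by rw [hb, RCLike.norm_ofReal, abs_of_pos (by positivity)]
  set f : Y := b • v E - v O + b • v P with hf
  have hcoord : ∀ D k, B.coord k (v D) = if k ∈ D then 1 else 0 := B.coord_sum_vec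
  have hproj : ∀ A D, B.proj A (v D) = v (A ∩ D) := B.proj_sum_vec
  have halt : ‖v E - v O‖ ≤ 1 := hW.norm_sub
  have hvP : ‖v P‖ ≤ 2 := hW.norm_P
  have hvE : ‖v E‖ ≤ g + 1 := by
    have := hW.norm_sum_le E hW.card_E (fun _ => 1) 1 zero_le_one (by simp)
    simpa using this
  have hmain : ‖b • v E - v O‖ ≤ 2 := by
    have h1 : b • v E - v O = (v E - v O) + (ε : 𝕜) • v E := by
      rw [hb, RCLike.ofReal_add, add_smul, RCLike.ofReal_one, one_smul]
      abel
    have h2 : ε * ‖v E‖ ≤ 1 := by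
      calc ε * ‖v E‖ ≤ ε * (g + 1) := by gcongr
        _ = 1 := by rw [hε]; field_simp
    rw [h1]
    refine (norm_add_le _ _).trans ?_
    rw [norm_smul, RCLike.norm_ofReal, abs_of_pos hε0]
    linarith
  have hcoordf : ∀ k, B.coord k f =
      (b * if k ∈ E then 1 else 0) - (if k ∈ O then 1 else 0) + b * if k ∈ P then 1 else 0 := by
    intro k
    rw [hf, map_add, map_sub, map_smul, map_smul, hcoord, hcoord, hcoord, smul_eq_mul, smul_eq_mul]
  obtain ⟨A, hAm, hA, hGA⟩ := hG m f
  have hAEP : A = E ∪ P := by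
    refine hA.eq_of_lt ?_ fun k hk n hn => ?_
    · rw [Finset.card_union_of_disjoint hEP, hW.card_P]
      have := hW.card_E
      omega
    · have h1 : ‖B.coord k f‖ = 1 + ε := by
        rcases Finset.mem_union.1 hk with hk | hk
        · simp [hcoordf, hk, Finset.disjoint_left.1 hEO hk, Finset.disjoint_left.1 hEP hk, hbn]
        · simp [hcoordf, hk, Finset.disjoint_right.1 hOP hk, Finset.disjoint_right.1 hEP hk, hbn]
      have h2 : ‖B.coord n f‖ ≤ 1 := by
        rw [Finset.notMem_union] at hn
        rw [hcoordf, if_neg hn.1, if_neg hn.2]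
        split_ifs <;> simp
      linarith
  have hGf : G m f = b • v E + b • v P := by
    rw [hGA, hAEP, hf, map_add, map_sub, map_smul, map_smul, hproj, hproj, hproj,
      Finset.union_inter_cancel_left, Finset.union_inter_cancel_right,
      Finset.disjoint_iff_inter_eq_empty.1 (Finset.disjoint_union_left.2 ⟨hEO, hOP.symm⟩)]
    simp [hv]
  refine ⟨f, ?_, ?_, ?_, ?_⟩
  · have h1 : ‖b • v P‖ ≤ 4 := by
      rw [norm_smul, hbn]
      nlinarith [norm_nonneg (v P)]
    refine (norm_add_le _ _).trans ?_
    linarith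
  · have h1 : f - B.proj Q f = b • v E - v O := by
      rw [hf, map_add, map_sub, map_smul, map_smul, hproj, hproj, hproj,
        Finset.disjoint_iff_inter_eq_empty.1 hW.disjoint_E_Q.symm,
        Finset.disjoint_iff_inter_eq_empty.1 hW.disjoint_O_Q.symm,
        Finset.inter_eq_right.2 hW.subset]
      simp [hv]
    rw [h1]
    exact hmain
  · have h1 : (g : ℝ) ≤ 4 * ‖v E + v P‖ := hW.le_norm_E_add_P
    rw [hGf, ← smul_add, norm_smul, hbn]
    nlinarith [norm_nonneg (v E + v P)]
  · have h1 : f - G m f = -v O := by rw [hGf, hf]; abel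
    rw [h1, norm_neg]
    exact hW.le_norm_O

/-- All constants of a basis that admits witnesses are determined up to a factor `24`. -/
theorem IsWitness.comparableWith (hW : B.IsWitness m g E O P Q) (hm : 1 ≤ m) :
    ComparableWith 24 (B.upperDemocracy m) g ∧
      ComparableWith 24 (B.upperSuperDemocracy m) g ∧
      (∀ G, B.IsGreedyAlgorithm G →
        ComparableWith 24 (B.lebesgueQuasiGreedy G m) g ∧
          ComparableWith 24 (B.lebesgueAlmostGreedy G m) g ∧
          ComparableWith 24 (B.lebesgue G m) g) ∧
      ComparableWith 24 (B.conditionality m) g ∧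
      ComparableWith 24 (B.lowerDemocracy m) 1 ∧
      ComparableWith 24 (B.lowerSuperDemocracy m) 1 := by
  have hg1 : (1 : ℝ) ≤ g := by exact_mod_cast hW.one_le
  have h24 : (24 : ℝ≥0) ≠ 0 := by norm_num
  have hg24 : (24 * g : ℝ≥0) ≠ 0 :=
    mul_ne_zero h24 (Nat.cast_ne_zero.2 (Nat.one_le_iff_ne_zero.1 hW.one_le))
  have hK := hW.norm_sum_le
  have hc := hW.norm_coord_le
  have hsign : ∀ A : Finset ℕ, A.card ≤ m → ∀ γ : ℕ → 𝕜, (∀ n, ‖γ n‖ = 1) →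
      ‖∑ n ∈ A, γ n • B.vec n‖ₑ ≤ (24 : ℝ≥0) * (g : ℝ≥0∞) := fun A hA γ hγ => by
    refine enorm_le_mul_natCast ((hK A hA γ 1 zero_le_one fun n _ => (hγ n).le).trans ?_)
    push_cast
    linarith
  have hlow : ∀ A : Finset ℕ, m ≤ A.card → ∀ γ : ℕ → 𝕜, (∀ n, ‖γ n‖ = 1) →
      (1 : ℝ≥0∞) / (24 : ℝ≥0) ≤ ‖∑ n ∈ A, γ n • B.vec n‖ₑ := fun A hA γ hγ => by
    rw [← ENNReal.le_coe_mul_iff h24, ← Nat.cast_one]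
    refine natCast_le_mul_enorm ?_
    obtain ⟨k, hk⟩ := Finset.card_pos.1 (by omega : 0 < A.card)
    have h1 := SemiNormalizedBasis.norm_coord_le hc k (∑ n ∈ A, γ n • B.vec n)
    rw [B.coord_sum_smul_vec, if_pos hk, hγ] at h1
    push_cast
    linarith
  have hE : (g : ℝ≥0∞) ≤ (24 : ℝ≥0) * ‖∑ j ∈ E, B.vec j‖ₑ :=
    natCast_le_mul_enorm
      (hW.le_norm_E.trans (mul_le_mul_of_nonneg_right (by norm_num) (norm_nonneg _)))
  have hQ : ‖∑ j ∈ Q, B.vec j‖ₑ ≤ (24 : ℝ≥0) * 1 := by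
    rw [← Nat.cast_one]
    refine enorm_le_mul_natCast (hW.norm_Q.trans ?_)
    norm_num
  refine ⟨⟨?_, ?_⟩, ⟨?_, ?_⟩, fun G hG => ?_, ⟨?_, ?_⟩, ⟨?_, ?_⟩, ⟨?_, ?_⟩⟩
  · exact iSup₂_le fun A hA => by simpa using hsign A hA (fun _ => 1) (by simp)
  · exact hE.trans (mul_le_mul_right
      (le_iSup₂ (f := fun (A : Finset ℕ) (_ : A.card ≤ m) => ‖∑ n ∈ A, B.vec n‖ₑ) E hW.card_E) _)
  · exact iSup₂_le fun A hA => iSup₂_le fun γ hγ => hsign A hA γ hγ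
  · refine hE.trans (mul_le_mul_right ?_ _)
    refine le_iSup₂_of_le E hW.card_E (le_iSup₂_of_le (fun _ => 1) (by simp) ?_)
    simp
  · have hcoe : (24 : ℝ≥0) * (g : ℝ≥0∞) = ((24 * g : ℝ≥0) : ℝ≥0∞) := by push_cast; rfl
    have hGle : ∀ f, ∀ D : Finset ℕ, D.card = m → ∀ a : ℕ → 𝕜,
        ‖f - G m f‖ₑ ≤ (24 : ℝ≥0) * (g : ℝ≥0∞) * ‖f - ∑ n ∈ D, a n • B.vec n‖ₑ := by
      intro f D hD a
      obtain ⟨A, hAm, hA, hGA⟩ := hG m f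
      have h1 := hA.norm_sub_proj_le hc hK hAm hD a
      rw [hcoe]
      refine enorm_le_mul_enorm ?_
      rw [hGA]
      refine h1.trans (mul_le_mul_of_nonneg_right ?_ (norm_nonneg _))
      push_cast
      linarith
    have hGq : ∀ f, ‖G m f‖ₑ ≤ (24 : ℝ≥0) * (g : ℝ≥0∞) * ‖f‖ₑ := by
      intro f
      obtain ⟨A, hAm, -, hGA⟩ := hG m f
      have h1 := norm_proj_apply_le hc hK hAm.le f
      rw [hcoe]
      refine enorm_le_mul_enorm ?_
      rw [hGA]
      refine h1.trans (mul_le_mul_of_nonneg_right ?_ (norm_nonneg _))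
      push_cast
      linarith
    obtain ⟨f, hf6, hf2, hG1, hG2⟩ := hW.exists_test_vector hG
    have h4 : ((4 * 6 : ℝ≥0) : ℝ≥0∞) = (24 : ℝ≥0) := by norm_num
    have h8 : ((12 * 2 : ℝ≥0) : ℝ≥0∞) = (24 : ℝ≥0) := by norm_num
    have hG3 : (g : ℝ) ≤ (12 : ℝ≥0) * ‖f - G m f‖ :=
      hG2.trans (mul_le_mul_of_nonneg_right (by norm_num) (norm_nonneg _))
    refine ⟨⟨sInf_le fun f => max_le (hGq f) ?_, ?_⟩, ⟨sInf_le fun f D hD => ?_, ?_⟩,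
      ⟨sInf_le fun f => ?_, ?_⟩⟩
    · simpa using hGle f Q hW.card_Q 0
    · rw [ENNReal.le_coe_mul_iff h24]
      refine le_sInf fun K hKf => ?_
      rw [← ENNReal.le_coe_mul_iff h24, ← h4]
      exact natCast_le_mul_of_enorm_le hG1 ((le_max_left _ _).trans (hKf f)) hf6
    · rw [B.proj_apply]
      exact hGle f D hD fun n => B.coord n f
    · rw [ENNReal.le_coe_mul_iff h24]
      refine le_sInf fun K hKf => ?_
      rw [← ENNReal.le_coe_mul_iff h24, ← h8]
      exact natCast_le_mul_of_enorm_le hG3 (hKf f Q hW.card_Q) hf2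
    · rw [hcoe, ENNReal.le_coe_mul_iff hg24, ← hcoe]
      refine le_iInf₂ fun D hD => le_iInf fun a => ?_
      rw [hcoe, ← ENNReal.le_coe_mul_iff hg24, ← hcoe]
      exact hGle f D hD a
    · rw [ENNReal.le_coe_mul_iff h24]
      refine le_sInf fun K hKf => ?_
      rw [← ENNReal.le_coe_mul_iff h24, ← h8]
      refine natCast_le_mul_of_enorm_le hG3 ((hKf f).trans (mul_le_mul_right ?_ K)) hf2
      refine (iInf₂_le Q hW.card_Q).trans ((iInf_le _ fun n => B.coord n f).trans ?_)
      rw [B.proj_apply]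
  · refine iSup₂_le fun A hA => enorm_le_mul_natCast ?_
    refine ContinuousLinearMap.opNorm_le_bound _ (by positivity) fun f => ?_
    refine (norm_proj_apply_le hc hK hA f).trans ?_
    refine mul_le_mul_of_nonneg_right ?_ (norm_nonneg _)
    push_cast
    linarith
  · have h1 : (g : ℝ) ≤ (24 : ℝ≥0) * ‖B.proj E‖ := by
      have h2 := (B.proj E).le_opNorm (∑ j ∈ E, B.vec j - ∑ j ∈ O, B.vec j)
      rw [map_sub, B.proj_sum_vec, B.proj_sum_vec, Finset.inter_self,
        Finset.disjoint_iff_inter_eq_empty.1 hW.disjoint_E_O, Finset.sum_empty, sub_zero] at h2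
      have h3 := h2.trans (mul_le_of_le_one_right (norm_nonneg _) hW.norm_sub)
      have h4 : (g : ℝ) ≤ 4 * ‖∑ j ∈ E, B.vec j‖ := hW.le_norm_E
      have h5 := norm_nonneg (B.proj E)
      push_cast
      linarith
    exact (natCast_le_mul_enorm h1).trans (mul_le_mul_right
      (le_iSup₂ (f := fun (A : Finset ℕ) (_ : A.card ≤ m) => ‖B.proj A‖ₑ) E hW.card_E) _)
  · exact iInf₂_le_of_le _ hW.card_Q.ge hQ
  · rw [ENNReal.le_coe_mul_iff h24]
    exact le_iInf₂ fun A hA => by simpa using hlow A hA (fun _ => 1) (by simp)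
  · refine iInf₂_le_of_le _ hW.card_Q.ge (iInf₂_le_of_le (fun _ => 1) (by simp) ?_)
    simpa using hQ
  · rw [ENNReal.le_coe_mul_iff h24]
    exact le_iInf₂ fun A hA => le_iInf₂ fun γ hγ => hlow A hA γ hγ

end SemiNormalizedBasis

/-! ### Witness sets for the dual Lindenstrauss basis -/

namespace Lindenstrauss

variable (𝕜 : Type*) [RCLike 𝕜] {d : ℕ → ℕ}

theorem one_le_Gamma (hd : ∀ n, 2 ≤ d n) {m : ℕ} (hm : 2 ≤ m) : 1 ≤ Gamma d m := by
  by_contra h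
  have h1 := ((Gamma_eq_iff hd (by omega : 1 ≤ m)).1 (Nat.lt_one_iff.1 (not_le.1 h))).2
  simp [Lambda, sigma] at h1
  omega

theorem card_evenGenerations_le (hd : ∀ n, 2 ≤ d n) {m h : ℕ} (hm : 1 ≤ m)
    (hh : 2 * h - 1 ≤ Gamma d m) : (evenGenerations d h).card ≤ m := by
  have h1 : evenGenerations d h ⊆ Finset.range ((sigma d)^[2 * h - 1] 0) := fun j hj =>
    Finset.mem_range.2 (lt_of_mem_evenGenerations hd hj)
  have h2 := Finset.card_le_card h1
  have h3 := ((Gamma_eq_iff hd hm).1 rfl).1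
  have h4 := (iterate_sigma_strictMono_index hd 0).monotone hh
  rw [Finset.card_range] at h2
  simp only [Lambda] at h3 h4
  omega

/-- The sum of the weights from the root is controlled by the norm, which gives lower estimates of
norms. -/
theorem norm_sum_weight_le (hd : ∀ n, 2 ≤ d n) {n : ℕ} {D : Finset ℕ}
    (hD : D ⊆ Finset.range ((sigma d)^[n] 0)) {φ : dualSpace 𝕜 d}
    (hφ : ∀ k < (sigma d)^[n] 0, dualCoord 𝕜 d k φ = if k ∈ D then 1 else 0) :
    ∑ k ∈ D, weight d 0 k ≤ 2 * ‖φ‖ := by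
  refine le_trans (le_of_eq ?_) (norm_sum_weight_mul_dualCoord_le 𝕜 hd n φ)
  have h1 : ∑ k ∈ Finset.range ((sigma d)^[n] 0), (weight d 0 k : 𝕜) * dualCoord 𝕜 d k φ =
      ((∑ k ∈ D, weight d 0 k : ℝ) : 𝕜) := by
    rw [Finset.sum_congr rfl fun k hk => by rw [hφ k (Finset.mem_range.1 hk)]]
    simp only [mul_ite, mul_one, mul_zero, Finset.sum_ite_mem, Finset.inter_eq_right.2 hD]
    push_cast
    rfl
  rw [h1, RCLike.norm_ofReal,
    abs_of_nonneg (Finset.sum_nonneg fun _ _ => weight_nonneg hd _ _)]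

/-- The even and the odd generations below the root, and far parts of the leftmost branch, are
witnesses for the dual Lindenstrauss basis. -/
theorem exists_isWitness (hd : ∀ n, 2 ≤ d n) (hmono : Monotone d) {m : ℕ} (hm : 2 ≤ m) :
    ∃ E O P Q, (dualBasis 𝕜 d hd).IsWitness m (Gamma d m) E O P Q := by
  have hg1 : 1 ≤ Gamma d m := one_le_Gamma hd hm
  -- the even generations of orders below `2 * h - 1 ≤ Γ(m)` have at most `m` elements
  obtain ⟨h, hh1, hh2⟩ : ∃ h, 2 * h - 1 ≤ Gamma d m ∧ Gamma d m ≤ 2 * h :=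
    ⟨(Gamma d m + 1) / 2, by omega, by omega⟩
  have hgh : (Gamma d m : ℝ) ≤ 2 * h := by exact_mod_cast hh2
  have hEN : ∀ j ∈ evenGenerations d h, j < (sigma d)^[2 * h] 0 := fun j hj =>
    (lt_of_mem_evenGenerations hd hj).trans_le
      ((iterate_sigma_strictMono_index hd 0).monotone (by omega))
  have hON : ∀ j ∈ oddGenerations d h, j < (sigma d)^[2 * h] 0 := fun j hj =>
    lt_of_mem_oddGenerations hd hj
  have hlower : ∀ D : Finset ℕ, D ⊆ Finset.range ((sigma d)^[2 * h] 0) →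
      ∑ k ∈ D, weight d 0 k = h → ∀ φ : dualSpace 𝕜 d,
      (∀ k < (sigma d)^[2 * h] 0, dualCoord 𝕜 d k φ = if k ∈ D then 1 else 0) →
      (Gamma d m : ℝ) ≤ 4 * ‖φ‖ := by
    intro D hD hsum φ hφ
    have h1 := norm_sum_weight_le 𝕜 hd hD hφ
    linarith
  have hcoord : ∀ (D : Finset ℕ) (k : ℕ),
      dualCoord 𝕜 d k (∑ j ∈ D, dualVec 𝕜 d j) = if k ∈ D then 1 else 0 :=
    (dualBasis 𝕜 d hd).coord_sum_vec
  have hEsub : evenGenerations d h ⊆ Finset.range ((sigma d)^[2 * h] 0) := fun j hj =>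
    Finset.mem_range.2 (hEN j hj)
  have hOsub : oddGenerations d h ⊆ Finset.range ((sigma d)^[2 * h] 0) := fun j hj =>
    Finset.mem_range.2 (hON j hj)
  exact ⟨evenGenerations d h, oddGenerations d h,
    branch d (2 * h) (m - (evenGenerations d h).card), branch d (2 * h) m,
    { one_le := hg1
      norm_coord_le := norm_dualCoord_le 𝕜 hd
      norm_sum_le := fun A hA a t ht ha =>
        norm_sum_dualVec_le_Gamma 𝕜 hd hmono (by omega) hA a ht ha
      card_E := card_evenGenerations_le hd (by omega) hh1
      card_P := card_branch hd _ _
      card_Q := card_branch hd _ _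
      subset := branch_subset d _ (Nat.sub_le _ _)
      disjoint_E_O := disjoint_evenGenerations_oddGenerations hd h
      disjoint_E_Q := Finset.disjoint_left.2 fun j h1 h2 =>
        (hEN j h1).not_ge (le_of_mem_branch hd h2)
      disjoint_O_Q := Finset.disjoint_left.2 fun j h1 h2 =>
        (hON j h1).not_ge (le_of_mem_branch hd h2)
      norm_sub := norm_sum_dualVec_even_sub_odd_le 𝕜 hd h
      norm_P := norm_sum_dualVec_branch_le 𝕜 hd _ _
      norm_Q := norm_sum_dualVec_branch_le 𝕜 hd _ _
      le_norm_E := hlower _ hEsub (sum_weight_evenGenerations hd h) _ fun k _ => hcoord _ k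
      le_norm_O := hlower _ hOsub (sum_weight_oddGenerations hd h) _ fun k _ => hcoord _ k
      le_norm_E_add_P :=
        hlower _ hEsub (sum_weight_evenGenerations hd h)
          (∑ j ∈ evenGenerations d h, dualVec 𝕜 d j +
            ∑ j ∈ branch d (2 * h) (m - (evenGenerations d h).card), dualVec 𝕜 d j)
          fun k hk => by
            rw [map_add, hcoord, hcoord, if_neg fun h1 => (le_of_mem_branch hd h1).not_gt hk,
              add_zero] }⟩

end Lindenstrauss

theorem mainTheorem12 (𝕜 : Type*) [RCLike 𝕜] :
    ∃ C : ℝ≥0, ∀ (d : ℕ → ℕ) (hd : ∀ n, 2 ≤ d n), Monotone d → ∀ m : ℕ, 2 ≤ m →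
      ComparableWith C ((Lindenstrauss.dualBasis 𝕜 d hd).upperDemocracy m)
          (Lindenstrauss.Gamma d m) ∧
        ComparableWith C ((Lindenstrauss.dualBasis 𝕜 d hd).upperSuperDemocracy m)
          (Lindenstrauss.Gamma d m) ∧
        (∀ G, (Lindenstrauss.dualBasis 𝕜 d hd).IsGreedyAlgorithm G →
          ComparableWith C ((Lindenstrauss.dualBasis 𝕜 d hd).lebesgueQuasiGreedy G m)
              (Lindenstrauss.Gamma d m) ∧
            ComparableWith C ((Lindenstrauss.dualBasis 𝕜 d hd).lebesgueAlmostGreedy G m)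
              (Lindenstrauss.Gamma d m) ∧
            ComparableWith C ((Lindenstrauss.dualBasis 𝕜 d hd).lebesgue G m)
              (Lindenstrauss.Gamma d m)) ∧
        ComparableWith C ((Lindenstrauss.dualBasis 𝕜 d hd).conditionality m)
          (Lindenstrauss.Gamma d m) ∧
        ComparableWith C ((Lindenstrauss.dualBasis 𝕜 d hd).lowerDemocracy m) 1 ∧
        ComparableWith C ((Lindenstrauss.dualBasis 𝕜 d hd).lowerSuperDemocracy m) 1 := by
  refine ⟨24, fun d hd hmono m hm => ?_⟩
  obtain ⟨E, O, P, Q, hW⟩ := Lindenstrauss.exists_isWitness 𝕜 hd hmono hm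
  exact hW.comparableWith (by omega)
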